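/- Let $(R,\mathfrak m)$ be a commutative Noetherian local ring and let $M,N$ be finitely generated $R$-modules with $M\neq 0$. For a finitely generated $R$-module $L$ of dimension $d$ put $e_R(L)=d!\,\lim_{j\to\infty}\ell_R(L/\mathfrak m^jL)/j^d$ (with $e_R(0)=0$), and let $\mu_R(L)$ be the minimal number of generators of $L$. A finitely generated module $M$ is called $c$-Ulrich, for a real number $c$, if $M$ is Cohen--Macaulay (that is, $M=0$ or $\operatorname{depth}_R M=\dim_R M$) and $e_R(M)\le c\,\mu_R(M)$. A module $L$ has rank $r$ if $L_{\mathfrak p}\cong R_{\mathfrak p}^{\oplus r}$ for all $\mathfrak p\in\operatorname{Ass}(R)$, and $L$ is free on $\operatorname{Ass}_R(M)$ if $L_{\mathfrak p}$ is a free $R_{\mathfrak p}$-module for all $\mathfrak p\in\operatorname{Ass}_R(M)$. Let $\Omega^i_RN$ denote the $i$th syzygy of $N$ in a minimal free resolution, with $\Omega^0_RN=N$. Assume that $M$ is $c$-Ulrich for some real number $c<2$, and that either $M$ has positive rank, or $N$ has rank and is free on $\operatorname{Ass}_R(M)$. Set $n=\dim_R M$, $v=\operatorname{depth}_R(M\otimes_RN)$,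 and \[ t=\begin{cases} \min\{\,s-1\in\mathbb Z_{\ge 0} \mid \operatorname{rank}_R(\Omega^{n-v}_RN)\cdot (c-1)^s<1\,\}, & \text{if $N$ has rank and is free on $\operatorname{Ass}_R(M)$},\\[4pt] \min\{\,s-1\in\mathbb Z_{\ge 0} \mid e_R(\Omega^{n-v}_RN)\cdot (c-1)^s<1\,\}, & \text{otherwise}. \end{cases} \] If $\operatorname{Tor}^R_i(M,N)=0$ for all $i=1,\dots,n-v+t$, then $\operatorname{pd}_R(N)<\infty$. (If $N=0$, the depth of $M\otimes_R N$ is infinite by convention and the conclusion is trivial.) -/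

import Mathlib

open CategoryTheory IsLocalRing
open scoped TensorProduct

universe u

noncomputable section

namespace CUlrich

/-- The dimension of a module as a natural number (for a nonzero finitely generated module over a
Noetherian local ring this is the usual dimension; it is `0` for the zero module). -/
def dimNat (R M : Type*) [CommRing R] [AddCommGroup M] [Module R M] : ℕ :=
  ((Module.supportDim R M).unbotD 0).toNat

/-- The depth of a module over a local ring: the supremum of the lengths of the `M`-regular
sequences contained in the maximal ideal. For a nonzero finitely generated module the condition
`(r₁, …, rₖ) M ≠ M` holds automatically for elements of the maximal ideal, so weak regularity is
asked for; in this way the zero module has depth `⊤`. -/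
def depth (R M : Type*) [CommRing R] [IsLocalRing R] [AddCommGroup M] [Module R M] : ℕ∞ :=
  ⨆ (rs : List R) (_ : (∀ r ∈ rs, r ∈ maximalIdeal R) ∧
    RingTheory.Sequence.IsWeaklyRegular M rs), (rs.length : ℕ∞)

/-- A module is Cohen-Macaulay if it is zero or its depth equals its dimension. -/
def IsCohenMacaulay (R M : Type*) [CommRing R] [IsLocalRing R] [AddCommGroup M] [Module R M] :
    Prop :=
  Subsingleton M ∨ (depth R M : WithBot ℕ∞) = Module.supportDim R M

/-- The length of `M / J M` as a natural number. -/
def colength {R : Type*} [CommRing R] (J : Ideal R) (M : Type*) [AddCommGroup M] [Module R M] :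
    ℕ :=
  (Module.length R (M ⧸ (J • (⊤ : Submodule R M)))).toNat

/-- The Hilbert-Samuel multiplicity
`e_R(I, M) = d! * lim_{n → ∞} length(M / I ^ n M) / n ^ d`, where `d = dim M`. For `M = 0` the
formula gives `0`. -/
def multiplicity {R : Type*} [CommRing R] (I : Ideal R) (M : Type*) [AddCommGroup M]
    [Module R M] : ℝ :=
  (Nat.factorial (dimNat R M) : ℝ) *
    Filter.limUnder Filter.atTop (fun n : ℕ => (colength (I ^ n) M : ℝ) / (n : ℝ) ^ dimNat R M)

/-- `M` is `c`-Ulrich with respect to the ideal `I`. -/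
structure IsUlrichWith {R : Type*} [CommRing R] [IsLocalRing R] (I : Ideal R) (c : ℝ)
    (M : Type*) [AddCommGroup M] [Module R M] : Prop where
  isCohenMacaulay : IsCohenMacaulay R M
  free : Module.Free (R ⧸ I) (M ⧸ (I • (⊤ : Submodule R M)))
  multiplicity_le : multiplicity I M ≤ c * (colength I M : ℝ)

/-- `M` is `c`-Ulrich: the case where `I` is the maximal ideal. -/
def IsUlrich (R : Type*) [CommRing R] [IsLocalRing R] (c : ℝ) (M : Type*) [AddCommGroup M]
    [Module R M] : Prop :=
  IsUlrichWith (maximalIdeal R) c M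

/-- The associated primes of `M`, as a subset of `Spec R`. -/
def Ass (R M : Type*) [CommRing R] [AddCommGroup M] [Module R M] : Set (PrimeSpectrum R) :=
  {p | p.asIdeal ∈ associatedPrimes R M}

/-- `M` is free on a subset `Y` of the spectrum: `M_p` is free over `R_p` for all `p ∈ Y`. -/
def IsFreeOn {R : Type*} [CommRing R] (Y : Set (PrimeSpectrum R)) (M : Type*) [AddCommGroup M]
    [Module R M] : Prop :=
  ∀ p ∈ Y, Module.Free (Localization p.asIdeal.primeCompl)
    (LocalizedModule p.asIdeal.primeCompl M)

/-- `M` has rank `r` on a subset `Y` of the spectrum: `M_p ≅ R_p ^ r` for all `p ∈ Y`. -/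
def HasRankOn {R : Type*} [CommRing R] (Y : Set (PrimeSpectrum R)) (M : Type*) [AddCommGroup M]
    [Module R M] (r : ℕ) : Prop :=
  ∀ p ∈ Y, Nonempty (LocalizedModule p.asIdeal.primeCompl M
    ≃ₗ[Localization p.asIdeal.primeCompl] (Fin r → Localization p.asIdeal.primeCompl))

/-- `M` has rank `r`: it has rank `r` on the associated primes of `R`. -/
def HasRank (R M : Type*) [CommRing R] [AddCommGroup M] [Module R M] (r : ℕ) : Prop :=
  HasRankOn (Ass R R) M r

/-- The rank of `M`: the `r` such that `M` has rank `r`. It is unique if there is one and `R` is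
nontrivial and Noetherian. -/
def rank (R M : Type*) [CommRing R] [AddCommGroup M] [Module R M] : ℕ :=
  sInf {r : ℕ | HasRank R M r}

/-- The surjection `R ^ μ(N) → N` given by a minimal set of generators of `N`. -/
def minimalCover (R N : Type*) [CommRing R] [AddCommGroup N] [Module R N] :
    ((⊤ : Submodule R N).generators →₀ R) →ₗ[R] N :=
  Finsupp.linearCombination R (fun g : (⊤ : Submodule R N).generators => (g : N))

/-- The `i`-th syzygy module `Ω^i N` in a minimal free resolution of `N`: `Ω^0 N = N`, and
`Ω^(i+1) N` is the kernel of the minimal cover of `Ω^i N`. -/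
def syzygy (R : Type u) [CommRing R] (N : Type u) [AddCommGroup N] [Module R N] :
    ℕ → ModuleCat.{u} R
  | 0 => ModuleCat.of R N
  | i + 1 => ModuleCat.of R (LinearMap.ker (minimalCover R (syzygy R N i)))

end CUlrich

end

set_option linter.unusedSectionVars false

namespace CUlrich

/-! Write X_i for the syzygy of N of index n - v + i. Vanishing of Tor makes 0 → M⊗Ω^(j+1)N → M⊗F_j
→ M⊗Ω^jN → 0 exact in the relevant range, so by the depth lemma depth grows by one with each syzygy
until it reaches n (`hasRegSeq_tensorProduct_syzygy`). Hence every M⊗X_i with i ≤ t has depth at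
least n and dimension at most n, and such a module has at most as many generators as its
multiplicity: μ(M)μ(X_i) ≤ e(M⊗X_i), where e is always normalised in degree n
(`generators_mul_colength_le`).

If N has a rank on Ass R and on Ass M, then e(M⊗X) = rank(X) e(M) ≤ rank(X) c μ(M), so μ(X) ≤ c
rank(X) and rank(ΩX) = μ(X) - rank(X) ≤ (c-1) rank(X). If M has positive rank s, then e(M⊗X) = s
e(X) and e(M) = s e(R), and additivity of e on 0 → ΩX → F → X → 0 gives e(ΩX) ≤ (c-1) e(X) in the
same way. After t+1 steps the invariant, a natural number, is below 1, hence zero. A syzygy lies in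
a free module, so a nonzero one is supported at an associated prime of R, and this is incompatible
with a vanishing invariant. So some syzygy of N is zero.

The multiplicity theory behind this is built from scratch. Existence, integrality, positivity and
the bound by generators (`hilbertSamuel`) go by induction on dimension: over R(X) the polynomial
whose coefficients generate the maximal ideal is a regular and superficial element. Dedekind-Mertens
and the Ratliff-Rush property prove this. Dévissage by prime cyclic modules gives the remaining
modules and the associativity formula (`hasMult_sum_localLength`), from which the two identities for
e(M⊗X) follow. -/

theorem artinRees_comap {R A B : Type*} [CommRing R] [IsNoetherianRing R] [AddCommGroup A]
    [Module R A] [AddCommGroup B] [Module R B] [Module.Finite R B] (f : A →ₗ[R] B) (hf : Function.Injective f)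
    (I : Ideal R) :
    ∃ c : ℕ, ∀ j, (I ^ (j + c) • (⊤ : Submodule R B)).comap f ≤ I ^ j • (⊤ : Submodule R A) := by
  obtain ⟨c, hc⟩ := Ideal.exists_pow_inf_eq_pow_smul I (LinearMap.range f)
  refine ⟨c, fun j x hx => ?_⟩
  have h1 : f x ∈ I ^ (j + c) • (⊤ : Submodule R B) ⊓ LinearMap.range f := ⟨hx, x, rfl⟩
  rw [hc _ (Nat.le_add_left _ _), Nat.add_sub_cancel] at h1
  have h2 : f x ∈ I ^ j • LinearMap.range f := Submodule.smul_mono le_rfl inf_le_right h1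
  rw [← Submodule.map_top, ← Submodule.map_smul''] at h2
  obtain ⟨y, hy, hxy⟩ := h2
  exact hf hxy ▸ hy

/-! ### Hilbert-Samuel functions and additivity of their leading coefficients -/

section Hilbert

open Filter Topology

variable {R : Type*} [CommRing R] [IsLocalRing R] [IsNoetherianRing R]

theorem length_ne_top_of_pow_smul_eq_bot (j : ℕ) (L : Type*) [AddCommGroup L] [Module R L]
    [Module.Finite R L] (h : maximalIdeal R ^ j • (⊤ : Submodule R L) = ⊥) :
    Module.length R L ≠ ⊤ := by
  induction j generalizing L with
  | zero =>
    have : Subsingleton L := by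
      rw [pow_zero, Ideal.one_eq_top, Submodule.top_smul] at h
      exact (Submodule.subsingleton_iff R).1 (subsingleton_of_bot_eq_top h.symm)
    simp
  | succ j ih =>
    let K : Submodule R L := maximalIdeal R • ⊤
    have hK : Module.length R K ≠ ⊤ := by
      apply ih
      apply Submodule.map_injective_of_injective K.injective_subtype
      rw [Submodule.map_smul'', Submodule.map_top, Submodule.range_subtype, Submodule.map_bot,
        ← h, pow_succ, mul_smul]
    have hQ : Module.length R (L ⧸ K) ≠ ⊤ := by
      let : Module (R ⧸ maximalIdeal R) (L ⧸ K) :=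
        inferInstanceAs (Module (R ⧸ maximalIdeal R) (L ⧸ maximalIdeal R • (⊤ : Submodule R L)))
      have : IsScalarTower R (R ⧸ maximalIdeal R) (L ⧸ K) :=
        inferInstanceAs (IsScalarTower R (R ⧸ maximalIdeal R)
          (L ⧸ maximalIdeal R • (⊤ : Submodule R L)))
      let : Field (R ⧸ maximalIdeal R) := Ideal.Quotient.field _
      have : Module.Finite (R ⧸ maximalIdeal R) (L ⧸ K) :=
        Module.Finite.of_restrictScalars_finite R _ _
      rw [Module.length_eq_of_surjective (S := R) (R := R ⧸ maximalIdeal R)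
        Ideal.Quotient.mk_surjective]
      exact Module.length_ne_top
    rw [Module.length_eq_add_of_exact K.subtype K.mkQ K.injective_subtype K.mkQ_surjective
      (LinearMap.exact_subtype_mkQ _)]
    simp [hK, hQ]

theorem length_quotient_ne_top (j : ℕ) (L : Type*) [AddCommGroup L] [Module R L]
    [Module.Finite R L] :
    Module.length R (L ⧸ (maximalIdeal R ^ j • (⊤ : Submodule R L))) ≠ ⊤ := by
  apply length_ne_top_of_pow_smul_eq_bot j
  rw [← Submodule.range_mkQ, LinearMap.range_eq_map, ← Submodule.map_smul'', Submodule.mkQ_map_self]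

/-- The Hilbert-Samuel function of `L` satisfies
`length (L / m ^ j L) / j ^ n → e / n!`. -/
def HasMult (R L : Type*) [CommRing R] [IsLocalRing R] [AddCommGroup L] [Module R L]
    (n : ℕ) (e : ℝ) : Prop :=
  Tendsto (fun j : ℕ => (colength (maximalIdeal R ^ j) L : ℝ) / (j : ℝ) ^ n) atTop
    (𝓝 (e / (Nat.factorial n : ℝ)))

theorem HasMult.unique {L : Type*} [AddCommGroup L] [Module R L] {n : ℕ} {e e' : ℝ}
    (h : HasMult R L n e) (h' : HasMult R L n e') : e = e' := by
  have := tendsto_nhds_unique h h'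
  have h0 : (Nat.factorial n : ℝ) ≠ 0 := by positivity
  field_simp at this
  exact this

variable {A B C : Type*} [AddCommGroup A] [Module R A] [AddCommGroup B]
  [Module R B] [AddCommGroup C] [Module R C]

theorem colength_congr (I : Ideal R) (e : A ≃ₗ[R] B) : colength I A = colength I B := by
  unfold colength
  congr 1
  refine (Submodule.Quotient.equiv _ _ e ?_).length_eq
  change Submodule.map e.toLinearMap _ = _
  rw [Submodule.map_smul'', Submodule.map_top, LinearEquiv.range]

theorem HasMult.congr (e : A ≃ₗ[R] B) {n : ℕ} {a : ℝ} (h : HasMult R A n a) : HasMult R B n a := by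
  unfold HasMult at *
  simpa only [colength_congr _ e] using h

theorem hasMult_of_subsingleton (n : ℕ) [Subsingleton A] : HasMult R A n 0 := by
  unfold HasMult colength
  simp

/-- The map f need not be injective: only the preimage of IB matters. This lets f be multiplication
by an element, or a tensored inclusion. -/
theorem length_quotient_of_exact (f : A →ₗ[R] B) (g : B →ₗ[R] C)
    (hg : Function.Surjective g) (hfg : Function.Exact f g) (I : Ideal R) :
    Module.length R (B ⧸ (I • (⊤ : Submodule R B))) =
      Module.length R (A ⧸ (I • (⊤ : Submodule R B)).comap f) +
        Module.length R (C ⧸ (I • (⊤ : Submodule R C))) := by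
  have h2 : I • (⊤ : Submodule R B) ≤ (I • (⊤ : Submodule R C)).comap g := by
    rw [← Submodule.map_le_iff_le_comap, Submodule.map_smul'']
    exact Submodule.smul_mono le_rfl le_top
  refine Module.length_eq_add_of_exact (Submodule.mapQ _ _ f le_rfl) (Submodule.mapQ _ _ g h2)
    ?_ ?_ ?_
  · rw [← LinearMap.ker_eq_bot, Submodule.ker_mapQ]
    rw [Submodule.mkQ_map_self]
  · rw [← LinearMap.range_eq_top, Submodule.range_mapQ, LinearMap.range_eq_top.2 hg]
    simp
  · rw [LinearMap.exact_iff, Submodule.ker_mapQ, Submodule.range_mapQ]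
    have : (I • (⊤ : Submodule R C)).comap g = I • (⊤ : Submodule R B) ⊔ LinearMap.ker g := by
      rw [← Submodule.comap_map_eq, Submodule.map_smul'', Submodule.map_top,
        LinearMap.range_eq_top.2 hg]
    rw [this, Submodule.map_sup, Submodule.mkQ_map_self, bot_sup_eq, hfg.linearMap_ker_eq]

theorem tendsto_shift_div {H : ℕ → ℝ} {n : ℕ} {l : ℝ} (c : ℕ)
    (h : Tendsto (fun j => H j / (j : ℝ) ^ n) atTop (𝓝 l)) :
    Tendsto (fun j => H (j - c) / (j : ℝ) ^ n) atTop (𝓝 l) := by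
  rw [← tendsto_add_atTop_iff_nat c]
  simp only [Nat.add_sub_cancel]
  have h1 : Tendsto (fun j : ℕ => ((j : ℝ) / ((j + c : ℕ) : ℝ)) ^ n) atTop (𝓝 1) := by
    have := (tendsto_natCast_div_add_atTop (𝕜 := ℝ) (c : ℝ)).pow n
    simpa using this
  have h2 := h.mul h1
  rw [mul_one] at h2
  refine h2.congr' ?_
  filter_upwards [eventually_ge_atTop 1] with j hj
  have : (j : ℝ) ≠ 0 := by positivity
  rw [div_pow]
  field_simp

/-- The filtration of A induced from B differs from the m-adic one by a bounded shift (Artin-Rees),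
and a shift does not change the limit after division by j^n. -/
theorem HasMult.of_exact [Module.Finite R A] [Module.Finite R B] [Module.Finite R C]
    {f : A →ₗ[R] B} {g : B →ₗ[R] C}
    (hf : Function.Injective f) (hg : Function.Surjective g) (hfg : Function.Exact f g) {n : ℕ}
    {a c : ℝ} (ha : HasMult R A n a) (hc : HasMult R C n c) : HasMult R B n (a + c) := by
  set m := maximalIdeal R
  obtain ⟨k, hk⟩ := artinRees_comap f hf m
  let T : ℕ → ℕ := fun j => (Module.length R (A ⧸ (m ^ j • (⊤ : Submodule R B)).comap f)).toNat
  have hle : ∀ j, m ^ j • (⊤ : Submodule R A) ≤ (m ^ j • (⊤ : Submodule R B)).comap f := by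
    intro j
    rw [← Submodule.map_le_iff_le_comap, Submodule.map_smul'']
    exact Submodule.smul_mono le_rfl le_top
  have hup' : ∀ j, Module.length R (A ⧸ (m ^ j • (⊤ : Submodule R B)).comap f) ≤
      Module.length R (A ⧸ m ^ j • (⊤ : Submodule R A)) := fun j =>
    Module.length_le_of_surjective _ (Submodule.factor_surjective (hle j))
  have hup : ∀ j, T j ≤ colength (m ^ j) A := fun j =>
    ENat.toNat_le_toNat (hup' j) (length_quotient_ne_top j A)
  have hlow : ∀ j, colength (m ^ j) A ≤ T (j + k) := fun j =>
    ENat.toNat_le_toNat (Module.length_le_of_surjective _ (Submodule.factor_surjective (hk j)))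
      (ne_top_of_le_ne_top (length_quotient_ne_top _ A) (hup' _))
  have hsum : ∀ j, colength (m ^ j) B = T j + colength (m ^ j) C := fun j => by
    unfold colength
    rw [length_quotient_of_exact f g hg hfg, ENat.toNat_add
      (ne_top_of_le_ne_top (length_quotient_ne_top _ A) (hup' _)) (length_quotient_ne_top _ C)]
  have hT : Tendsto (fun j : ℕ => (T j : ℝ) / (j : ℝ) ^ n) atTop (𝓝 (a / n.factorial)) := by
    refine tendsto_of_tendsto_of_tendsto_of_le_of_le' (tendsto_shift_div k ha) ha ?_ ?_
    · filter_upwards [eventually_ge_atTop k] with j hj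
      have := hlow (j - k)
      rw [Nat.sub_add_cancel hj] at this
      gcongr
    · exact Eventually.of_forall fun j => by gcongr; exact hup j
  have := hT.add hc
  unfold HasMult
  rw [add_div]
  refine this.congr fun j => ?_
  rw [hsum]
  push_cast
  ring

theorem hasMult_of_length_ne_top [Module.Finite R A] (h : Module.length R A ≠ ⊤) :
    HasMult R A 0 (Module.length R A).toNat ∧
      ∀ n, HasMult R A (n + 1) 0 := by
  obtain ⟨j0, hj0⟩ : ∃ j0, ∀ j ≥ j0, maximalIdeal R ^ j • (⊤ : Submodule R A) = ⊥ := by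
    have hfl := Module.length_ne_top_iff.1 h
    have := (isFiniteLength_iff_isNoetherian_isArtinian.1 hfl).2
    obtain ⟨k, hk⟩ := IsArtinian.monotone_stabilizes (R := R) (M := A)
      ⟨fun j => OrderDual.toDual (maximalIdeal R ^ j • (⊤ : Submodule R A)), fun i j hij =>
        Submodule.smul_mono_left (Ideal.pow_le_pow_right hij)⟩
    have hk' : ∀ j ≥ k, maximalIdeal R ^ k • (⊤ : Submodule R A) =
      maximalIdeal R ^ j • (⊤ : Submodule R A) := hk
    have h0 := Ideal.iInf_pow_smul_eq_bot_of_isLocalRing (M := A) (maximalIdeal R)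
      Ideal.IsPrime.ne_top'
    have hz : maximalIdeal R ^ k • (⊤ : Submodule R A) = ⊥ := by
      rw [eq_bot_iff, ← h0]
      refine le_iInf fun j => ?_
      rcases le_total k j with hkj | hkj
      · exact (hk' j hkj).le
      · exact Submodule.smul_mono_left (Ideal.pow_le_pow_right hkj)
    exact ⟨k, fun j hj => (hk' j hj) ▸ hz⟩
  have hev : ∀ᶠ j in atTop, (colength (maximalIdeal R ^ j) A : ℝ) = (Module.length R A).toNat := by
    filter_upwards [eventually_ge_atTop j0] with j hj
    unfold colength
    rw [(Submodule.quotEquivOfEqBot _ (hj0 j hj)).length_eq]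
  constructor
  · unfold HasMult
    refine tendsto_const_nhds.congr' ?_
    filter_upwards [hev] with j hj
    simp [hj]
  · intro n
    unfold HasMult
    rw [zero_div]
    have : Tendsto (fun j : ℕ => ((Module.length R A).toNat : ℝ) / (j : ℝ) ^ (n + 1)) atTop (𝓝 0) :=
      Tendsto.div_atTop tendsto_const_nhds
        ((tendsto_pow_atTop (Nat.succ_ne_zero n)).comp tendsto_natCast_atTop_atTop)
    refine this.congr' ?_
    filter_upwards [hev] with j hj
    rw [hj]

end Hilbert

/-! ### The Dedekind-Mertens lemma for polynomials with module coefficients -/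

section DedekindMertens

open Polynomial

variable {R : Type*} [CommRing R] {L : Type*} [AddCommGroup L] [Module R L]

theorem coeff_sub (x y : PolynomialModule R L) (i : ℕ) :
    (x - y).coeff i = x.coeff i - y.coeff i := rfl

theorem coeff_smul (r : R) (x : PolynomialModule R L) (i : ℕ) :
    (r • x).coeff i = r • x.coeff i := rfl

theorem _root_.Ideal.sup_pow_succ_le (I J : Ideal R) (k : ℕ) :
    (I ⊔ J) ^ (k + 1) ≤ I ^ (k + 1) ⊔ (I ⊔ J) ^ k * J := by
  induction k with
  | zero => simp
  | succ k ih =>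
    rw [pow_succ (I ⊔ J) (k + 1)]
    refine (Ideal.mul_sup _ _ _).le.trans (sup_le ?_ le_sup_right)
    refine (Ideal.mul_mono_left ih).trans ?_
    rw [Ideal.sup_mul]
    refine sup_le (le_sup_of_le_left (pow_succ _ _).ge) (le_sup_of_le_right ?_)
    rw [mul_assoc, mul_comm J I, ← mul_assoc]
    refine Ideal.mul_mono_left ?_
    rw [pow_succ]
    exact Ideal.mul_mono_right le_sup_left

/-- A form of the Dedekind-Mertens lemma: `c(f) ^ (k + 1) c(g) ⊆ c(f) ^ k c(f g)` if `g` has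
degree at most `k`. -/
theorem dedekindMertens (k r : ℕ) (f : R[X]) (hf : ∀ i, r ≤ i → f.coeff i = 0)
    (g : PolynomialModule R L) (hg : ∀ i, k < i → g.coeff i = 0) (W : Submodule R L)
    (hW : ∀ i, (f • g).coeff i ∈ W) (i : ℕ) :
    f.contentIdeal ^ (k + 1) • Submodule.span R {g.coeff i} ≤ f.contentIdeal ^ k • W := by
  induction k using Nat.strong_induction_on generalizing r f g W i with
  | _ k ihk =>
    induction r generalizing f W i with
    | zero =>
      have : f = 0 := by ext i; simpa using hf i (Nat.zero_le _)
      subst this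
      rw [contentIdeal_zero, pow_succ, Ideal.mul_bot, Submodule.bot_smul]
      exact bot_le
    | succ r ihr =>
      set C := f.contentIdeal with hC
      have htop : ∀ K : ℕ, (∀ i, K < i → g.coeff i = 0) → f.coeff r • g.coeff K ∈ W := by
        intro K hK
        have := hW (r + K)
        rw [PolynomialModule.smul_apply, Finset.sum_eq_single (r, K)] at this
        · exact this
        · rintro ⟨a, b⟩ hab hne
          rw [Finset.HasAntidiagonal.mem_antidiagonal] at hab
          simp only at hab
          rcases lt_trichotomy a r with h | h | h
          · rw [hK b (by omega), smul_zero]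
          · exact absurd (by rw [h, show b = K by omega]) hne
          · rw [hf a h, zero_smul]
        · intro h
          simp at h
      -- Induction on the degree of g: removing the top term from f_r g lowers the degree, and the
      -- product with f then has coefficients in C W, because the product of the top coefficients of
      -- f and g lies in W.
      have part1 : ∀ i, C ^ k • Submodule.span R {f.coeff r • g.coeff i} ≤ C ^ k • W := by
        intro i
        rcases k with _ | k
        · refine Submodule.smul_mono le_rfl ?_
          rw [Submodule.span_singleton_le_iff_mem]
          rcases Nat.eq_zero_or_pos i with rfl | hi
          · exact htop 0 hg
          · rw [hg i hi, smul_zero]; exact W.zero_mem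
        · have key := ihk k k.lt_succ_self (r + 1) f hf
             (f.coeff r • g - PolynomialModule.single R (k + 1) (f.coeff r • g.coeff (k + 1)))
             (by
               intro i hi
               rw [CUlrich.coeff_sub, CUlrich.coeff_smul, PolynomialModule.coeff_single]
               rcases eq_or_lt_of_le (Nat.succ_le_of_lt hi) with h | h
               · subst h; simp
               · rw [hg i h, Finsupp.single_apply, if_neg (by omega)]; simp)
             (C • W)
             (by
               intro i
               rw [smul_sub, smul_comm, CUlrich.coeff_sub, CUlrich.coeff_smul]
               refine Submodule.sub_mem _
                 (Submodule.smul_mem_smul (coeff_mem_contentIdeal _ _) (hW i)) ?_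
               rw [PolynomialModule.smul_single_apply]
               split_ifs
               · exact Submodule.smul_mem_smul (coeff_mem_contentIdeal _ _) (htop (k + 1) hg)
               · exact Submodule.zero_mem _) i
          rw [← mul_smul, ← pow_succ] at key
          rcases lt_trichotomy i (k + 1) with h | h | h
          · rw [CUlrich.coeff_sub, CUlrich.coeff_smul, PolynomialModule.coeff_single] at key
            simpa [Finsupp.single_apply, h.ne'] using key
          · subst h
            exact Submodule.smul_mono le_rfl
              ((Submodule.span_singleton_le_iff_mem _ _).2 (htop _ hg))
          · rw [hg i h]; simp
      have hsup : C ≤ (f.erase r).contentIdeal ⊔ Ideal.span {f.coeff r} := by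
        rw [hC, contentIdeal_def, Ideal.span_le]
        intro x hx
        obtain ⟨n, -, rfl⟩ := mem_coeffs_iff.1 hx
        by_cases h : n = r
        · subst h
          exact Ideal.mem_sup_right (Ideal.mem_span_singleton_self _)
        · apply Ideal.mem_sup_left
          rw [← erase_ne f h]
          exact coeff_mem_contentIdeal _ _
      have hle : (f.erase r).contentIdeal ≤ C := by
        rw [contentIdeal_def, Ideal.span_le]
        intro x hx
        obtain ⟨n, -, rfl⟩ := mem_coeffs_iff.1 hx
        rw [coeff_erase]
        split_ifs
        · exact C.zero_mem
        · exact coeff_mem_contentIdeal _ _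
      have hle2 : Ideal.span {f.coeff r} ≤ C := by
        rw [Ideal.span_singleton_le_iff_mem]
        exact coeff_mem_contentIdeal _ _
      let G : Submodule R L := Submodule.span R (Set.range fun n => f.coeff r • g.coeff n)
      -- Induction on the length of f: dropping its leading term changes the product with g only by
      -- multiples f_r g_n, which generate G and are controlled by `part1`.
      have key2 := ihr (f.erase r)
        (by
          intro n hn
          rw [coeff_erase]
          split_ifs with h
          · rfl
          · exact hf n (by omega)) (W ⊔ G)
        (by
          intro n
          have h1 : f.erase r • g = f • g - monomial r (f.coeff r) • g := by
            rw [← sub_smul, eq_sub_of_add_eq' (monomial_add_erase f r)]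
          rw [h1, CUlrich.coeff_sub,
            PolynomialModule.monomial_smul_apply]
          refine Submodule.sub_mem _ (Submodule.mem_sup_left (hW n)) ?_
          split_ifs
          · exact Submodule.mem_sup_right (Submodule.subset_span ⟨_, rfl⟩)
          · exact Submodule.zero_mem _) i
      have hG : ∀ {K : ℕ}, (∀ i, C ^ K • Submodule.span R {f.coeff r • g.coeff i} ≤ C ^ K • W) →
          C ^ K • G ≤ C ^ K • W := by
        intro K h
        rw [Submodule.smul_le]
        intro a ha x hx
        induction hx using Submodule.span_induction with
        | mem x hx =>
          obtain ⟨n, rfl⟩ := hx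
          exact h n (Submodule.smul_mem_smul ha (Submodule.mem_span_singleton_self _))
        | zero => simp
        | add x y _ _ hx hy => rw [smul_add]; exact Submodule.add_mem _ hx hy
        | smul b x _ hx => rw [smul_comm]; exact Submodule.smul_mem _ _ hx
      have hC2 : C = (f.erase r).contentIdeal ⊔ Ideal.span {f.coeff r} :=
        le_antisymm hsup (sup_le hle hle2)
      have h3 := Ideal.sup_pow_succ_le (f.erase r).contentIdeal (Ideal.span {f.coeff r})
      rw [← hC2] at h3
      refine (Submodule.smul_mono_left (h3 _)).trans ?_
      rw [Submodule.sup_smul]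
      refine sup_le (key2.trans ?_) ?_
      · refine (Submodule.smul_mono_left (Ideal.pow_right_mono hle _)).trans ?_
        rw [Submodule.smul_sup]
        exact sup_le le_rfl (hG part1)
      · rw [mul_smul]
        convert part1 i using 2
        rw [Submodule.ideal_span_singleton_smul, Submodule.smul_span]
        simp

theorem exists_dedekindMertens (f : R[X]) (g : PolynomialModule R L) (W : Submodule R L)
    (hW : ∀ i, (f • g).coeff i ∈ W) :
    ∃ k, ∀ i, f.contentIdeal ^ (k + 1) • Submodule.span R {g.coeff i} ≤ f.contentIdeal ^ k • W := by
  obtain ⟨k, hk⟩ : ∃ k, ∀ i, k < i → g.coeff i = 0 := by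
    refine ⟨g.coeff.support.sup id, fun i hi => ?_⟩
    by_contra h
    exact absurd (Finset.le_sup (f := id) (Finsupp.mem_support_iff.2 h)) (not_le.2 hi)
  exact ⟨k, dedekindMertens k (f.natDegree + 1) f (fun i hi => coeff_eq_zero_of_natDegree_lt hi) g
    hk W hW⟩

end DedekindMertens

/-! ### The Ratliff-Rush property of large powers of an ideal -/

section RatliffRush

variable {R : Type*} [CommRing R] [IsNoetherianRing R] {L : Type*} [AddCommGroup L] [Module R L]
  [Module.Finite R L]

/-- The elements `g` of `I ^ j L` with `I ^ k g ⊆ I ^ (j + k + 1) L` for some `k`. -/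
def ratliffRushFiltration (I : Ideal R) (L : Type*) [AddCommGroup L] [Module R L] :
    I.Filtration L where
  N j :=
    { carrier := {g | g ∈ I ^ j • (⊤ : Submodule R L) ∧
        ∃ k, ∀ a ∈ I ^ k, a • g ∈ I ^ (j + k + 1) • (⊤ : Submodule R L)}
      add_mem' := by
        rintro x y ⟨hx, k, hk⟩ ⟨hy, l, hl⟩
        refine ⟨Submodule.add_mem _ hx hy, k + l, fun a ha => ?_⟩
        have h : ∀ (z : L) (p q : ℕ), (∀ a ∈ I ^ p, a • z ∈ I ^ (j + p + 1) • (⊤ : Submodule R L)) →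
            ∀ a ∈ I ^ (p + q), a • z ∈ I ^ (j + (p + q) + 1) • (⊤ : Submodule R L) := by
          intro z p q hz a ha
          rw [pow_add, mul_comm] at ha
          refine Submodule.mul_induction_on ha (fun b hb c hc => ?_) fun b c hb hc => ?_
          · rw [mul_smul, show j + (p + q) + 1 = q + (j + p + 1) by omega, pow_add I q, mul_smul]
            exact Submodule.smul_mem_smul hb (hz c hc)
          · rw [add_smul]; exact Submodule.add_mem _ hb hc
        rw [smul_add]
        refine Submodule.add_mem _ (h x k l hk a ha) ?_
        rw [add_comm k l] at ha ⊢
        exact h y l k hl a ha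
      zero_mem' := ⟨Submodule.zero_mem _, 0, by simp⟩
      smul_mem' := by
        rintro b x ⟨hx, k, hk⟩
        refine ⟨Submodule.smul_mem _ _ hx, k, fun a ha => ?_⟩
        rw [smul_comm]
        exact Submodule.smul_mem _ _ (hk a ha) }
  mono j := by
    rintro x ⟨hx, -⟩
    refine ⟨Submodule.smul_mono_left (Ideal.pow_le_pow_right (Nat.le_succ j)) hx, 0, ?_⟩
    intro a _
    exact Submodule.smul_mem _ _ hx
  smul_le j := by
    rw [Submodule.smul_le]
    rintro b hb x ⟨hx, k, hk⟩
    refine ⟨?_, k, fun a ha => ?_⟩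
    · rw [pow_succ', mul_smul]
      exact Submodule.smul_mem_smul hb hx
    · rw [smul_comm, show j + 1 + k + 1 = (j + k + 1) + 1 by omega, pow_succ', mul_smul]
      exact Submodule.smul_mem_smul hb (hk a ha)

/-- The auxiliary filtration sits inside the stable I-adic one, so it is stable. The finitely many
generators of its b-th term share one exponent K, and from degree b + K on the j-th term lies in
I^(j+1) L. -/
theorem exists_ratliffRush_succ (I : Ideal R) (L : Type*) [AddCommGroup L] [Module R L]
    [Module.Finite R L] :
    ∃ j0, ∀ j ≥ j0, ∀ g ∈ I ^ j • (⊤ : Submodule R L), ∀ k,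
      (∀ a ∈ I ^ k, a • g ∈ I ^ (j + k + 1) • (⊤ : Submodule R L)) →
      g ∈ I ^ (j + 1) • (⊤ : Submodule R L) := by
  have hst : (ratliffRushFiltration I L).Stable := by
    refine Ideal.Filtration.Stable.of_le (Ideal.stableFiltration_stable I ⊤) ?_
    intro j x hx
    exact hx.1
  obtain ⟨b, hb⟩ := hst.exists_pow_smul_eq_of_ge
  obtain ⟨s, hs⟩ := IsNoetherian.noetherian ((ratliffRushFiltration I L).N b)
  have hex : ∀ x : s, ∃ k, ∀ a ∈ I ^ k, a • (x : L) ∈ I ^ (b + k + 1) • (⊤ : Submodule R L) :=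
    fun x => (show (x : L) ∈ (ratliffRushFiltration I L).N b from
      hs ▸ Submodule.subset_span x.2).2
  choose κ hκ using hex
  let K := Finset.univ.sup κ
  have hK : I ^ K • (ratliffRushFiltration I L).N b ≤ I ^ (b + K + 1) • (⊤ : Submodule R L) := by
    rw [← hs, Submodule.smul_le]
    intro a ha x hx
    induction hx using Submodule.span_induction with
    | mem x hx =>
      have hle : κ ⟨x, hx⟩ ≤ K := Finset.le_sup (f := κ) (Finset.mem_univ _)
      obtain ⟨d, hd⟩ := Nat.exists_eq_add_of_le hle
      rw [hd, pow_add, mul_comm] at ha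
      refine Submodule.mul_induction_on ha (fun p hp q hq => ?_) fun p q hp hq => ?_
      · rw [mul_smul, hd, show b + (κ ⟨x, hx⟩ + d) + 1 = d + (b + κ ⟨x, hx⟩ + 1) by omega,
          pow_add I d, mul_smul]
        exact Submodule.smul_mem_smul hp (hκ ⟨x, hx⟩ q hq)
      · rw [add_smul]; exact Submodule.add_mem _ hp hq
    | zero => simp
    | add x y _ _ hx hy => rw [smul_add]; exact Submodule.add_mem _ hx hy
    | smul c x _ hx => rw [smul_comm]; exact Submodule.smul_mem _ _ hx
  refine ⟨b + K, fun j hj g hg k hk => ?_⟩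
  have h1 : g ∈ (ratliffRushFiltration I L).N j := ⟨hg, k, hk⟩
  rw [hb j (by omega), show j - b = (j - b - K) + K by omega, pow_add, mul_smul] at h1
  have h2 := Submodule.smul_mono le_rfl hK h1
  rwa [← mul_smul, ← pow_add, show j - b - K + (b + K + 1) = j + 1 by omega] at h2

/-- The preceding lemma climbs one power at a time, but only from I^j0 L upwards. Multiplying g by
x^j0 provides that start, and Artin-Rees for this injective multiplication brings g itself into I^j0
L, from where it climbs to I^j L. -/
theorem exists_ratliffRush {I : Ideal R} {x : R} (hx : x ∈ I) (hreg : IsSMulRegular L x) :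
    ∃ j1, ∀ j ≥ j1, ∀ (g : L) (k : ℕ),
      (∀ a ∈ I ^ k, a • g ∈ I ^ (j + k) • (⊤ : Submodule R L)) →
      g ∈ I ^ j • (⊤ : Submodule R L) := by
  obtain ⟨j0, hj0⟩ := exists_ratliffRush_succ I L
  have step : ∀ (d i : ℕ) (g : L) (k : ℕ), j0 ≤ i → g ∈ I ^ i • (⊤ : Submodule R L) →
      (∀ a ∈ I ^ k, a • g ∈ I ^ (i + d + k) • (⊤ : Submodule R L)) →
      g ∈ I ^ (i + d) • (⊤ : Submodule R L) := by
    intro d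
    induction d with
    | zero => intro i g k _ hg _; exact hg
    | succ d ih =>
      intro i g k hi hg hk
      have h1 := hj0 i hi g hg k fun a ha =>
        Submodule.smul_mono_left (Ideal.pow_le_pow_right (by omega)) (hk a ha)
      have h2 := ih (i + 1) g k (by omega) h1 (fun a ha => by
        have := hk a ha
        rwa [show i + (d + 1) + k = i + 1 + d + k by omega] at this)
      rwa [show i + (d + 1) = i + 1 + d by omega]
  obtain ⟨c, hc⟩ := artinRees_comap (LinearMap.lsmul R L (x ^ j0)) (hreg.pow j0) I
  refine ⟨j0 + c, fun j hj g k hk => ?_⟩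
  have h1 : x ^ j0 • g ∈ I ^ (j0 + j) • (⊤ : Submodule R L) := by
    refine step j j0 _ k le_rfl (Submodule.smul_mem_smul (Ideal.pow_mem_pow hx _) trivial) ?_
    intro a ha
    rw [smul_comm, add_assoc, pow_add, mul_smul]
    exact Submodule.smul_mem_smul (Ideal.pow_mem_pow hx _) (hk a ha)
  have h2 : g ∈ I ^ j0 • (⊤ : Submodule R L) := by
    apply hc j0
    exact Submodule.smul_mono_left (Ideal.pow_le_pow_right (by omega)) h1
  have := step (j - j0) j0 g k le_rfl h2 (fun a ha => by
    rw [show j0 + (j - j0) = j by omega]; exact hk a ha)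
  rwa [show j0 + (j - j0) = j by omega] at this

end RatliffRush

/-! ### The flat local extension R(X) -/

noncomputable section GenericExtension

open Polynomial

variable (R : Type u) [CommRing R] [IsLocalRing R]

/-- The ring `R(X)`: the localization of `R[X]` at the extension of the maximal ideal. -/
def GenericExt : Type u := Localization.AtPrime ((maximalIdeal R).map (C : R →+* R[X]))

namespace GenericExt

instance : CommRing (GenericExt R) :=
  inferInstanceAs (CommRing (Localization.AtPrime ((maximalIdeal R).map (C : R →+* R[X]))))

instance : Algebra R[X] (GenericExt R) :=
  inferInstanceAs (Algebra R[X] (Localization.AtPrime ((maximalIdeal R).map (C : R →+* R[X]))))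

instance : IsLocalization.AtPrime (GenericExt R) ((maximalIdeal R).map (C : R →+* R[X])) :=
  Localization.isLocalization

instance : Algebra R (GenericExt R) :=
  ((algebraMap R[X] (GenericExt R)).comp (algebraMap R R[X])).toAlgebra

instance : IsScalarTower R R[X] (GenericExt R) := IsScalarTower.of_algebraMap_eq fun _ => rfl

instance : IsLocalRing (GenericExt R) :=
  IsLocalization.AtPrime.isLocalRing _ ((maximalIdeal R).map (C : R →+* R[X]))

instance [IsNoetherianRing R] : IsNoetherianRing (GenericExt R) :=
  IsLocalization.isNoetherianRing ((maximalIdeal R).map (C : R →+* R[X])).primeCompl _ inferInstance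

instance : Module.Flat R (GenericExt R) :=
  have : Module.Flat R[X] (GenericExt R) :=
    IsLocalization.flat _ ((maximalIdeal R).map (C : R →+* R[X])).primeCompl
  Module.Flat.trans R R[X] _

end GenericExt

theorem maximalIdeal_genericExt :
    maximalIdeal (GenericExt R) = (maximalIdeal R).map (algebraMap R (GenericExt R)) := by
  rw [IsScalarTower.algebraMap_eq R R[X] (GenericExt R), ← Ideal.map_map,
    ← IsLocalization.AtPrime.map_eq_maximalIdeal ((maximalIdeal R).map (C : R →+* R[X]))]
  rfl

instance : IsLocalHom (algebraMap R (GenericExt R)) := by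
  apply ((IsLocalRing.local_hom_TFAE _).out 0 2).2
  rw [maximalIdeal_genericExt]

/-- For a flat local extension, length is multiplied by the length of the closed fibre, which here
is the residue field of R(X). -/
theorem length_genericExt (M : Type*) [AddCommGroup M] [Module R M] :
    Module.length (GenericExt R) (GenericExt R ⊗[R] M) = Module.length R M := by
  rw [IsLocalRing.length_baseChange, ← maximalIdeal_genericExt]
  have h : Module.length (GenericExt R) (GenericExt R ⧸ maximalIdeal (GenericExt R)) = 1 :=
    Module.length_eq_one_iff.2
      (isSimpleModule_iff_isCoatom.2 (IsLocalRing.maximalIdeal.isMaximal (GenericExt R)).out)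
  rw [h, mul_one]

end GenericExtension

/-! ### L[X] as a base change of L, and quotients under base change -/

noncomputable section PolynomialBaseChange

open Polynomial

variable {R L Q : Type*} [CommRing R] [AddCommGroup L] [Module R L] [AddCommMonoid Q]
  [Module R Q] [Module R[X] Q] [IsScalarTower R R[X] Q]

/-- The extension of an `R`-linear map `L → Q` to a polynomial module `Q` to `L[X]`. -/
def polyLift (g : L →ₗ[R] Q) : PolynomialModule R L →ₗ[R[X]] Q where
  toFun h := h.coeff.sum fun i m => (X ^ i : R[X]) • g m
  map_add' x y := by
    rw [PolynomialModule.coeff_add, Finsupp.sum_add_index'] <;> simp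
  map_smul' p h := by
    have hadd : ∀ x y : PolynomialModule R L,
        (x + y).coeff.sum (fun i m => (X ^ i : R[X]) • g m) =
        x.coeff.sum (fun i m => (X ^ i : R[X]) • g m) +
        y.coeff.sum (fun i m => (X ^ i : R[X]) • g m) := fun x y => by
      rw [PolynomialModule.coeff_add, Finsupp.sum_add_index'] <;> simp
    simp only [RingHom.id_apply]
    induction p using Polynomial.induction_on' with
    | add p q hp hq => rw [add_smul, hadd, hp, hq, add_smul]
    | monomial n a =>
      induction h using PolynomialModule.induction_linear with
      | zero => simp
      | add x y hx hy => rw [smul_add, hadd, hx, hy, hadd, smul_add]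
      | single i m =>
        rw [PolynomialModule.monomial_smul_single, PolynomialModule.coeff_single,
          PolynomialModule.coeff_single, Finsupp.sum_single_index (by simp),
          Finsupp.sum_single_index (by simp), map_smul, pow_add, ← C_mul_X_pow_eq_monomial,
          ← algebraMap_smul R[X] a, ← mul_smul, ← mul_smul, Polynomial.algebraMap_eq]
        ring_nf

@[simp]
theorem polyLift_single (g : L →ₗ[R] Q) (i : ℕ) (m : L) :
    polyLift g (PolynomialModule.single R i m) = (X ^ i : R[X]) • g m := by
  change ((PolynomialModule.single R i m).coeff.sum fun i m => (X ^ i : R[X]) • g m) = _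
  rw [PolynomialModule.coeff_single, Finsupp.sum_single_index (by simp)]

theorem isBaseChange_polynomialModule :
    IsBaseChange R[X] (PolynomialModule.lsingle R 0 : L →ₗ[R] PolynomialModule R L) := by
  refine IsBaseChange.of_lift_unique _ fun Q _ _ _ _ g => ⟨polyLift g, ?_, fun g' hg' => ?_⟩
  · ext m
    change polyLift g (PolynomialModule.single R 0 m) = _
    simp
  · refine LinearMap.ext fun h => ?_
    induction h using PolynomialModule.induction_linear with
    | zero => simp
    | add x y hx hy => rw [map_add, map_add, hx, hy]
    | single i m =>
      rw [polyLift_single, ← hg', show PolynomialModule.single R i m =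
        (X ^ i : R[X]) • PolynomialModule.single R 0 m by
          rw [← monomial_one_right_eq_X_pow, PolynomialModule.monomial_smul_single]; simp, map_smul]
      rfl

end PolynomialBaseChange

section BaseChangeQuotient

variable {R S L : Type*} [CommRing R] [CommRing S] [Algebra R S] [AddCommGroup L] [Module R L]

theorem tmul_mem_map_smul_top (I : Ideal R) (s : S) {x : L} (hx : x ∈ I • (⊤ : Submodule R L)) :
    s ⊗ₜ[R] x ∈ I.map (algebraMap R S) • (⊤ : Submodule S (S ⊗[R] L)) := by
  refine Submodule.smul_induction_on hx (fun r hr n _ => ?_) fun x y hx hy => ?_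
  · rw [TensorProduct.tmul_smul, ← algebraMap_smul S r]
    exact Submodule.smul_mem_smul (Ideal.mem_map_of_mem _ hr) Submodule.mem_top
  · rw [TensorProduct.tmul_add]
    exact Submodule.add_mem _ hx hy

theorem ker_baseChange_mkQ (I : Ideal R) :
    LinearMap.ker ((I • (⊤ : Submodule R L)).mkQ.baseChange S) =
      I.map (algebraMap R S) • (⊤ : Submodule S (S ⊗[R] L)) := by
  apply le_antisymm
  · intro z hz
    have h := lTensor_exact S (LinearMap.exact_subtype_mkQ (I • (⊤ : Submodule R L)))
      (Submodule.mkQ_surjective _)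
    obtain ⟨w, rfl⟩ := (h z).1 hz
    induction w using TensorProduct.induction_on with
    | zero => simp
    | tmul s x => exact tmul_mem_map_smul_top I s x.2
    | add x y hx hy =>
      rw [map_add]
      exact Submodule.add_mem _
        (hx ((h _).2 ⟨x, rfl⟩)) (hy ((h _).2 ⟨y, rfl⟩))
  · rw [Submodule.smul_le]
    intro r hr z _
    rw [LinearMap.mem_ker, map_smul]
    suffices ∀ w : S ⊗[R] (L ⧸ I • (⊤ : Submodule R L)), r • w = 0 from this _
    intro w
    refine Submodule.span_induction (p := fun r _ => r • w = 0) ?_ (zero_smul _ _)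
      (fun a b _ _ ha hb => by rw [add_smul, ha, hb, add_zero])
      (fun a b _ hb => by rw [smul_assoc, hb, smul_zero]) hr
    rintro _ ⟨a, ha, rfl⟩
    rw [algebraMap_smul]
    induction w using TensorProduct.induction_on with
    | zero => simp
    | add x y hx hy => rw [smul_add, hx, hy, add_zero]
    | tmul s x =>
      obtain ⟨x, rfl⟩ := Submodule.mkQ_surjective _ x
      rw [← TensorProduct.tmul_smul, ← map_smul, Submodule.mkQ_apply,
        (Submodule.Quotient.mk_eq_zero _).2 (Submodule.smul_mem_smul ha Submodule.mem_top),
        TensorProduct.tmul_zero]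

/-- Base change commutes with the quotient by an ideal multiple. -/
noncomputable def quotMapSMulEquiv (I : Ideal R) :
    ((S ⊗[R] L) ⧸ (I.map (algebraMap R S) • (⊤ : Submodule S (S ⊗[R] L)))) ≃ₗ[S]
      S ⊗[R] (L ⧸ (I • (⊤ : Submodule R L))) :=
  (Submodule.quotEquivOfEq _ _ (ker_baseChange_mkQ I).symm).trans
    (LinearMap.quotKerEquivOfSurjective _
      (LinearMap.lTensor_surjective S (Submodule.mkQ_surjective _)))

end BaseChangeQuotient

/-! ### The generic element of the maximal ideal is regular and superficial -/

section GenericElement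

open Polynomial

variable {R : Type u} [CommRing R] [IsLocalRing R] {L : Type u} [AddCommGroup L] [Module R L]

theorem colength_genericExt (j : ℕ) :
    colength (maximalIdeal (GenericExt R) ^ j) (GenericExt R ⊗[R] L) =
      colength (maximalIdeal R ^ j) L := by
  unfold colength
  rw [maximalIdeal_genericExt, ← Ideal.map_pow, (quotMapSMulEquiv (S := GenericExt R) (L := L) (maximalIdeal R ^ j)).length_eq,
    length_genericExt]

theorem contentIdeal_eq_top {f : R[X]} (hf : f ∈ ((maximalIdeal R).map (C : R →+* R[X])).primeCompl) :
    f.contentIdeal = ⊤ := by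
  by_contra h
  apply hf
  have := IsLocalRing.le_maximalIdeal h
  exact Ideal.mem_map_C_iff.2 fun n => this (coeff_mem_contentIdeal _ _)

variable (R L) in
/-- The canonical map `L[X] → R(X) ⊗ L`. -/
noncomputable def toGenericExt : PolynomialModule R L →ₗ[R[X]] GenericExt R ⊗[R] L :=
  polyLift (TensorProduct.mk R (GenericExt R) L 1)

instance isLocalizedModule_toGenericExt :
    IsLocalizedModule ((maximalIdeal R).map (C : R →+* R[X])).primeCompl (toGenericExt R L) := by
  rw [isLocalizedModule_iff_isBaseChange _ (GenericExt R)]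
  refine IsBaseChange.of_comp (isBaseChange_polynomialModule (R := R) (L := L)) ?_
  convert TensorProduct.isBaseChange R L (GenericExt R)
  ext m
  change toGenericExt R L (PolynomialModule.single R 0 m) = _
  simp [toGenericExt]

/-- A denominator has a unit coefficient, so its content ideal is R, and Dedekind-Mertens with W = 0
shows that it is a nonzerodivisor on L[X]. -/
theorem toGenericExt_injective : Function.Injective (toGenericExt R L) := by
  rw [injective_iff_map_eq_zero]
  intro h hh
  rw [IsLocalizedModule.eq_zero_iff ((maximalIdeal R).map (C : R →+* R[X])).primeCompl] at hh
  obtain ⟨f, hf⟩ := hh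
  obtain ⟨k, hk⟩ := exists_dedekindMertens f.1 h ⊥ fun i => by
    rw [show (f : R[X]) • h = 0 from hf]; simp
  ext i
  have := hk i
  rw [contentIdeal_eq_top f.2, ← Ideal.one_eq_top, one_pow] at this
  simpa using this

theorem baseChange_toGenericExt {E : Type u} [AddCommGroup E] [Module R E] (φ : L →ₗ[R] E)
    (h : PolynomialModule R L) :
    φ.baseChange (GenericExt R) (toGenericExt R L h) =
      toGenericExt R E (PolynomialModule.map R φ h) := by
  induction h using PolynomialModule.induction_linear with
  | zero => simp
  | add x y hx hy => rw [map_add, map_add, hx, hy, map_add, map_add]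
  | single i m =>
    rw [PolynomialModule.map_single, toGenericExt, toGenericExt, polyLift_single, polyLift_single,
      ← algebraMap_smul (GenericExt R) (X ^ i : R[X]),
      ← algebraMap_smul (GenericExt R) (X ^ i : R[X]), map_smul]
    rfl

/-- This is injectivity of L[X] → R(X)⊗L applied to L/IL. -/
theorem toGenericExt_mem_iff (I : Ideal R) (h : PolynomialModule R L) :
    toGenericExt R L h ∈ I.map (algebraMap R (GenericExt R)) •
      (⊤ : Submodule (GenericExt R) (GenericExt R ⊗[R] L)) ↔
    ∀ i, h.coeff i ∈ I • (⊤ : Submodule R L) := by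
  rw [← ker_baseChange_mkQ, LinearMap.mem_ker, baseChange_toGenericExt,
    map_eq_zero_iff _ toGenericExt_injective, PolynomialModule.ext_iff, DFunLike.ext_iff]
  refine forall_congr' fun i => ?_
  rw [← Submodule.Quotient.mk_eq_zero]
  rfl

end GenericElement

section GenericElement

open Polynomial Pointwise

variable {R : Type u} [CommRing R] [IsLocalRing R] {L : Type u} [AddCommGroup L] [Module R L]

theorem _root_.Ideal.FG.exists_contentIdeal_eq {R : Type*} [CommRing R] {I : Ideal R}
    (hI : I.FG) : ∃ f : R[X], f.contentIdeal = I := by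
  obtain ⟨n, s, rfl⟩ := Submodule.fg_iff_exists_fin_generating_family.1 hI
  have hc : ∀ j : Fin n, (∑ i : Fin n, monomial (i : ℕ) (s i)).coeff j = s j := by
    intro j
    rw [finsetSum_coeff, Finset.sum_eq_single j]
    · simp
    · intro b _ hb
      rw [coeff_monomial, if_neg (fun h => hb (Fin.ext h))]
    · simp
  refine ⟨∑ i : Fin n, monomial (i : ℕ) (s i), le_antisymm ?_ ?_⟩
  · rw [contentIdeal_def, Ideal.span_le]
    intro x hx
    obtain ⟨k, -, rfl⟩ := mem_coeffs_iff.1 hx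
    rw [finsetSum_coeff]
    refine Submodule.sum_mem _ fun i _ => ?_
    rw [coeff_monomial]
    split_ifs
    · exact Submodule.subset_span ⟨i, rfl⟩
    · exact Submodule.zero_mem _
  · rw [Submodule.span_le]
    rintro _ ⟨i, rfl⟩
    rw [← hc i]
    exact coeff_mem_contentIdeal _ _

theorem exists_smul_eq_toGenericExt (z : GenericExt R ⊗[R] L) :
    ∃ (u : (GenericExt R)ˣ) (h : PolynomialModule R L), u • z = toGenericExt R L h := by
  obtain ⟨⟨h, s⟩, hs⟩ := IsLocalizedModule.surj
    ((maximalIdeal R).map (C : R →+* R[X])).primeCompl (toGenericExt R L) z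
  obtain ⟨u, hu⟩ := IsLocalization.map_units (GenericExt R) s
  refine ⟨u, h, ?_⟩
  rw [← hs, Units.smul_def, hu, algebraMap_smul]
  rfl

variable {f : R[X]} (hf : f.contentIdeal = maximalIdeal R)
include hf

theorem generic_mem_maximalIdeal :
    algebraMap R[X] (GenericExt R) f ∈ maximalIdeal (GenericExt R) := by
  rw [maximalIdeal_genericExt, IsScalarTower.algebraMap_eq R R[X] (GenericExt R), ← Ideal.map_map]
  refine Ideal.mem_map_of_mem _ (Ideal.mem_map_C_iff.2 fun n => ?_)
  rw [← hf]
  exact coeff_mem_contentIdeal _ _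

/-- If f h = 0, Dedekind-Mertens shows that a power of the content ideal m kills the coefficients of
h; a power of x then kills them too. -/
theorem generic_isSMulRegular {x : R} (hx : x ∈ maximalIdeal R) (hreg : IsSMulRegular L x) :
    IsSMulRegular (GenericExt R ⊗[R] L) (algebraMap R[X] (GenericExt R) f) := by
  refine (injective_iff_map_eq_zero
    (LinearMap.lsmul (GenericExt R) (GenericExt R ⊗[R] L) (algebraMap R[X] (GenericExt R) f))).2 ?_
  intro z hz
  rw [LinearMap.lsmul_apply] at hz
  obtain ⟨u, h, hu⟩ := exists_smul_eq_toGenericExt z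
  have h1 : f • h = 0 := by
    apply toGenericExt_injective
    rw [map_smul, ← hu, smul_comm, ← algebraMap_smul (GenericExt R) f, hz, smul_zero, map_zero]
  obtain ⟨k, hk⟩ := exists_dedekindMertens f h ⊥ (by rw [h1]; simp)
  have h2 : h = 0 := by
    ext i
    have := hk i
    rw [hf, Submodule.smul_bot, le_bot_iff] at this
    have h3 : x ^ (k + 1) • h.coeff i ∈ (⊥ : Submodule R L) := by
      rw [← this]
      exact Submodule.smul_mem_smul (Ideal.pow_mem_pow hx _) (Submodule.mem_span_singleton_self _)
    rw [Submodule.mem_bot] at h3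
    exact (isSMulRegular_iff_right_eq_zero_of_smul.1 (hreg.pow (k + 1))) _ h3
  rw [h2, map_zero] at hu
  exact (smul_eq_zero_iff_eq u).1 hu

/-- If f h has coefficients in m^(j+1) L, Dedekind-Mertens puts m^(k+1) h_i in m^(j+k+1) L, and the
Ratliff-Rush property cancels m^(k+1). -/
theorem generic_superficial [IsNoetherianRing R] [Module.Finite R L] {x : R}
    (hx : x ∈ maximalIdeal R) (hreg : IsSMulRegular L x) :
    ∃ j1, ∀ j ≥ j1, ∀ z : GenericExt R ⊗[R] L,
      algebraMap R[X] (GenericExt R) f • z ∈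
        maximalIdeal (GenericExt R) ^ (j + 1) • (⊤ : Submodule (GenericExt R) _) →
      z ∈ maximalIdeal (GenericExt R) ^ j • (⊤ : Submodule (GenericExt R) _) := by
  obtain ⟨j1, hj1⟩ := exists_ratliffRush (L := L) hx hreg
  refine ⟨j1, fun j hj z hz => ?_⟩
  obtain ⟨u, h, hu⟩ := exists_smul_eq_toGenericExt z
  have h1 : toGenericExt R L (f • h) ∈
      maximalIdeal (GenericExt R) ^ (j + 1) • (⊤ : Submodule (GenericExt R) _) := by
    rw [map_smul, ← hu, smul_comm, ← algebraMap_smul (GenericExt R) f]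
    exact Submodule.smul_mem _ (u : GenericExt R) hz
  rw [maximalIdeal_genericExt, ← Ideal.map_pow] at h1 ⊢
  obtain ⟨k, hk⟩ := exists_dedekindMertens f h _ ((toGenericExt_mem_iff _ _).1 h1)
  have h2 : toGenericExt R L h ∈ (maximalIdeal R ^ j).map (algebraMap R (GenericExt R)) •
      (⊤ : Submodule (GenericExt R) _) := by
    rw [toGenericExt_mem_iff]
    intro i
    refine hj1 j hj _ (k + 1) fun a ha => ?_
    have := hk i (by
      rw [hf]; exact Submodule.smul_mem_smul ha (Submodule.mem_span_singleton_self _))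
    rwa [hf, ← mul_smul, ← pow_add, show k + (j + 1) = j + (k + 1) by omega] at this
  rw [← hu] at h2
  have := Submodule.smul_mem _ (↑u⁻¹ : GenericExt R) h2
  rwa [Units.smul_def, smul_smul, Units.inv_mul, one_smul] at this

/-- Superficiality identifies the preimage of m^(j+1) under multiplication by the generic element
with m^j, so the first difference of the Hilbert-Samuel function of L is the function of a quotient
by a regular element. -/
theorem generic_colength_succ [IsNoetherianRing R] [Module.Finite R L] {x : R}
    (hx : x ∈ maximalIdeal R) (hreg : IsSMulRegular L x) :
    ∃ j1, ∀ j ≥ j1, colength (maximalIdeal R ^ (j + 1)) L = colength (maximalIdeal R ^ j) L +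
      colength (maximalIdeal (GenericExt R) ^ (j + 1))
        (QuotSMulTop (algebraMap R[X] (GenericExt R) f) (GenericExt R ⊗[R] L)) := by
  obtain ⟨j1, hj1⟩ := generic_superficial hf hx hreg
  refine ⟨j1, fun j hj => ?_⟩
  rw [← colength_genericExt, ← colength_genericExt (L := L) j]
  unfold colength
  let y := algebraMap R[X] (GenericExt R) f
  have hex : Function.Exact (LinearMap.lsmul (GenericExt R) (GenericExt R ⊗[R] L) y)
      (y • (⊤ : Submodule (GenericExt R) (GenericExt R ⊗[R] L))).mkQ := by
    rw [LinearMap.exact_iff, Submodule.ker_mkQ]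
    ext w
    constructor
    · rintro ⟨v, -, rfl⟩; exact ⟨v, rfl⟩
    · rintro ⟨v, rfl⟩; exact ⟨v, trivial, rfl⟩
  rw [length_quotient_of_exact _ _ (Submodule.mkQ_surjective _) hex]
  have hcomap : (maximalIdeal (GenericExt R) ^ (j + 1) • (⊤ : Submodule (GenericExt R)
      (GenericExt R ⊗[R] L))).comap (LinearMap.lsmul (GenericExt R) (GenericExt R ⊗[R] L) y) =
      maximalIdeal (GenericExt R) ^ j • (⊤ : Submodule (GenericExt R) (GenericExt R ⊗[R] L)) := by
    apply le_antisymm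
    · intro z hz
      exact hj1 j hj z hz
    · intro z hz
      rw [Submodule.mem_comap, pow_succ', mul_smul]
      exact Submodule.smul_mem_smul (generic_mem_maximalIdeal hf) hz
  rw [hcomap, ENat.toNat_add (length_quotient_ne_top j _)]
  exact length_quotient_ne_top (j + 1) (QuotSMulTop y (GenericExt R ⊗[R] L))

end GenericElement

/-! ### Dimension is unchanged by passing to R(X) -/

section Dimension

open Polynomial

variable {R : Type u} [CommRing R] [IsLocalRing R] [IsNoetherianRing R]

theorem genericExt_isPrime_map (p : Ideal R) [p.IsPrime] :
    (p.map (algebraMap R (GenericExt R))).IsPrime ∧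
      (p.map (algebraMap R (GenericExt R))).comap (algebraMap R (GenericExt R)) = p := by
  have hdis : Disjoint (((maximalIdeal R).map (C : R →+* R[X])).primeCompl : Set R[X])
      (p.map (C : R →+* R[X]) : Ideal R[X]) := by
    rw [Set.disjoint_left]
    intro g hg hg'
    exact hg (Ideal.map_mono (IsLocalRing.le_maximalIdeal Ideal.IsPrime.ne_top') hg')
  have hp : (p.map (C : R →+* R[X])).IsPrime := inferInstance
  rw [IsScalarTower.algebraMap_eq R R[X] (GenericExt R), ← Ideal.map_map, ← Ideal.comap_comap]
  refine ⟨IsLocalization.isPrime_of_isPrime_disjoint _ _ _ hp hdis, ?_⟩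
  have h := IsLocalization.under_map_of_isPrime_disjoint
    ((maximalIdeal R).map (C : R →+* R[X])).primeCompl (GenericExt R) hp hdis
  rw [Ideal.under_def] at h
  rw [Polynomial.algebraMap_eq, h]
  ext a
  rw [Ideal.mem_comap, Ideal.mem_map_C_iff]
  refine ⟨fun h => by simpa using h 0, fun h n => ?_⟩
  rw [coeff_C]
  split_ifs
  · exact h
  · exact p.zero_mem

/-- Chains of primes extend by p ↦ pR(X), which is injective by contraction. The extension stays in
the support: p contains an associated prime q, and R/q ⊆ L remains an inclusion after flat base
change. -/
theorem supportDim_le_genericExt (L : Type u) [AddCommGroup L] [Module R L] [Module.Finite R L] :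
    Module.supportDim R L ≤ Module.supportDim (GenericExt R) (GenericExt R ⊗[R] L) := by
  have hmem : ∀ p ∈ Module.support R L,
      (⟨_, (genericExt_isPrime_map p.asIdeal).1⟩ : PrimeSpectrum (GenericExt R)) ∈
        Module.support (GenericExt R) (GenericExt R ⊗[R] L) := by
    intro p hp
    rw [Module.mem_support_iff_of_finite] at hp
    obtain ⟨q, hq, hqp⟩ := Ideal.exists_minimalPrimes_le hp
    have hq' := Module.associatedPrimes.minimalPrimes_annihilator_subset_associatedPrimes R L hq
    obtain ⟨hqprime, g, hg⟩ := (isAssociatedPrime_iff_exists_injective_linearMap _ _).1 hq'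
    have hinj : Function.Injective (g.baseChange (GenericExt R)) :=
      Module.Flat.lTensor_preserves_injective_linearMap g hg
    apply Module.support_subset_of_injective _ hinj
    rw [← (Algebra.TensorProduct.quotIdealMapEquivTensorQuot
      (GenericExt R) q).toLinearEquiv.support_eq]
    rw [Module.mem_support_iff_of_finite, Ideal.annihilator_quotient]
    exact Ideal.map_mono hqp
  refine Order.krullDim_le_of_strictMono (fun p => ⟨_, hmem p.1 p.2⟩) ?_
  intro p q hpq
  refine lt_of_le_of_ne (Ideal.map_mono hpq.le) fun h => hpq.ne ?_
  have h' : p.1.asIdeal.map (algebraMap R (GenericExt R)) =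
      q.1.asIdeal.map (algebraMap R (GenericExt R)) := congrArg (fun x => x.1.asIdeal) h
  apply Subtype.ext
  apply PrimeSpectrum.ext
  rw [← (genericExt_isPrime_map p.1.asIdeal).2, h', (genericExt_isPrime_map q.1.asIdeal).2]

/-- Modulo the annihilator of L, the height of the maximal ideal upstairs is at most the height
downstairs plus that of the closed fibre, and the fibre is a field. -/
theorem genericExt_supportDim_le (L : Type u) [AddCommGroup L] [Module R L] [Module.Finite R L] :
    Module.supportDim (GenericExt R) (GenericExt R ⊗[R] L) ≤ Module.supportDim R L := by
  rcases subsingleton_or_nontrivial L with hL | hL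
  · rw [Module.supportDim_eq_bot_of_subsingleton (R := GenericExt R)]
    exact bot_le
  set I := Module.annihilator R L
  have hI : I ≠ ⊤ := by
    intro h
    rw [Module.annihilator_eq_top_iff] at h
    exact not_subsingleton L h
  set J := I.map (algebraMap R (GenericExt R))
  have hIm : I ≤ maximalIdeal R := IsLocalRing.le_maximalIdeal hI
  have hJm : J ≤ maximalIdeal (GenericExt R) := by
    rw [maximalIdeal_genericExt]; exact Ideal.map_mono hIm
  have hJ : J ≠ ⊤ := fun h => Ideal.IsPrime.ne_top' (top_le_iff.1 (h ▸ hJm))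
  have h1 : Module.supportDim (GenericExt R) (GenericExt R ⊗[R] L) ≤ ringKrullDim (GenericExt R ⧸ J) := by
    rw [← Module.supportDim_quotient_eq_ringKrullDim]
    have hsub : Module.support (GenericExt R) (GenericExt R ⊗[R] L) ⊆
        Module.support (GenericExt R) (GenericExt R ⧸ J) := by
      intro P hP
      rw [Module.mem_support_iff_of_finite, Ideal.annihilator_quotient]
      rw [Module.mem_support_iff_of_finite] at hP
      refine le_trans ?_ hP
      rw [Ideal.map_le_iff_le_comap]
      intro a ha
      rw [Ideal.mem_comap, Module.mem_annihilator]
      intro z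
      rw [algebraMap_smul]
      induction z using TensorProduct.induction_on with
      | zero => simp
      | add x y hx hy => rw [smul_add, hx, hy, add_zero]
      | tmul s x => rw [← TensorProduct.tmul_smul, Module.mem_annihilator.1 ha, TensorProduct.tmul_zero]
    exact Order.krullDim_le_of_strictMono (fun p => ⟨p.1, hsub p.2⟩) fun p q h => h
  refine h1.trans ?_
  rw [Module.supportDim_eq_ringKrullDim_quotient_annihilator]
  have : Nontrivial (R ⧸ I) := Ideal.Quotient.nontrivial_iff.2 hI
  have : Nontrivial (GenericExt R ⧸ J) := Ideal.Quotient.nontrivial_iff.2 hJ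
  have : IsLocalRing (R ⧸ I) := IsLocalRing.of_surjective' _ Ideal.Quotient.mk_surjective
  have : IsLocalRing (GenericExt R ⧸ J) := IsLocalRing.of_surjective' _ Ideal.Quotient.mk_surjective
  have hmapI : maximalIdeal (R ⧸ I) = (maximalIdeal R).map (algebraMap R (R ⧸ I)) :=
    (IsLocalRing.map_maximalIdeal_of_surjective _ Ideal.Quotient.mk_surjective).symm
  have hmapJ : maximalIdeal (GenericExt R ⧸ J) =
      (maximalIdeal (R ⧸ I)).map (algebraMap (R ⧸ I) (GenericExt R ⧸ J)) := by
    rw [hmapI, Ideal.map_map, ← IsScalarTower.algebraMap_eq R (R ⧸ I) (GenericExt R ⧸ J),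
      IsScalarTower.algebraMap_eq R (GenericExt R) (GenericExt R ⧸ J), ← Ideal.map_map,
      ← maximalIdeal_genericExt]
    exact (IsLocalRing.map_maximalIdeal_of_surjective _ Ideal.Quotient.mk_surjective).symm
  have hlo : (maximalIdeal (GenericExt R ⧸ J)).LiesOver (maximalIdeal (R ⧸ I)) := by
    refine ⟨(maximalIdeal.isMaximal (R ⧸ I)).eq_of_le ?_ ?_⟩
    · rw [Ideal.under_def]
      exact Ideal.comap_ne_top _ Ideal.IsPrime.ne_top'
    · rw [Ideal.under_def, ← Ideal.map_le_iff_le_comap, hmapJ]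
  rw [← IsLocalRing.maximalIdeal_height_eq_ringKrullDim,
    ← IsLocalRing.maximalIdeal_height_eq_ringKrullDim]
  have h2 := Ideal.height_le_height_add_of_liesOver (maximalIdeal (R ⧸ I))
    (maximalIdeal (GenericExt R ⧸ J))
  rw [← hmapJ, Ideal.map_quotient_self] at h2
  have : Nontrivial ((GenericExt R ⧸ J) ⧸ maximalIdeal (GenericExt R ⧸ J)) :=
    Ideal.Quotient.nontrivial_iff.2 Ideal.IsPrime.ne_top'
  rw [Ideal.height_bot, add_zero] at h2
  exact_mod_cast h2

theorem supportDim_genericExt (L : Type u) [AddCommGroup L] [Module R L] [Module.Finite R L] :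
    Module.supportDim (GenericExt R) (GenericExt R ⊗[R] L) = Module.supportDim R L :=
  le_antisymm (genericExt_supportDim_le L) (supportDim_le_genericExt L)

end Dimension

/-! ### Depth through regular sequences and Ext -/

section RegularSequences

open RingTheory.Sequence Abelian Pointwise

variable (R : Type u) [CommRing R] [IsLocalRing R]

/-- There is a (weakly) `L`-regular sequence of length `n` in the maximal ideal. -/
def HasRegSeq (L : Type*) [AddCommGroup L] [Module R L] (n : ℕ) : Prop :=
  ∃ rs : List R, rs.length = n ∧ (∀ r ∈ rs, r ∈ maximalIdeal R) ∧ IsWeaklyRegular L rs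

variable {R} [IsNoetherianRing R]

theorem subsingleton_ext_of_subsingleton (X : ModuleCat.{u} R) (L : Type u) [AddCommGroup L]
    [Module R L] [Subsingleton L] (i : ℕ) : Subsingleton (Ext X (ModuleCat.of R L) i) := by
  have h : Limits.IsZero (ModuleCat.of R L) := ModuleCat.isZero_of_subsingleton _
  refine ⟨fun a b => ?_⟩
  rw [← Ext.comp_mk₀_id a, ← Ext.comp_mk₀_id b, h.eq_of_src (𝟙 _) 0]
  simp

theorem smul_top_lt_top (L : Type*) [AddCommGroup L] [Module R L] [Module.Finite R L]
    [Nontrivial L] : maximalIdeal R • (⊤ : Submodule R L) < ⊤ := by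
  rw [lt_top_iff_ne_top]
  intro h
  have := Submodule.eq_bot_of_le_smul_of_le_jacobson_bot (maximalIdeal R) (⊤ : Submodule R L)
    Module.Finite.fg_top h.ge (IsLocalRing.maximalIdeal_le_jacobson _)
  exact top_ne_bot this

theorem support_residue : Module.support R (R ⧸ maximalIdeal R) =
    PrimeSpectrum.zeroLocus (maximalIdeal R) := by
  rw [Module.support_eq_zeroLocus, Ideal.annihilator_quotient]

theorem isWeaklyRegular_replicate_zero (L : Type*) [AddCommGroup L] [Module R L] [Subsingleton L]
    (n : ℕ) : IsWeaklyRegular L (List.replicate n (0 : R)) := by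
  induction n generalizing L with
  | zero => simp
  | succ n ih =>
    rw [List.replicate_succ, isWeaklyRegular_cons_iff]
    have : Subsingleton (QuotSMulTop (0 : R) L) :=
      (Submodule.mkQ_surjective ((0 : R) • (⊤ : Submodule R L))).subsingleton
    exact ⟨fun a b _ => Subsingleton.elim _ _, ih _⟩

/-- Rees' characterisation of depth. The zero module fits in too: all its Ext groups vanish, and
sequences of zeros are weakly regular on it. -/
theorem hasRegSeq_iff_ext (L : Type u) [AddCommGroup L] [Module R L] [Module.Finite R L] (n : ℕ) :
    HasRegSeq R L n ↔
      ∀ i < n, Subsingleton (Ext (ModuleCat.of R (R ⧸ maximalIdeal R)) (ModuleCat.of R L) i) := by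
  rcases subsingleton_or_nontrivial L with hL | hL
  · refine ⟨fun _ i _ => subsingleton_ext_of_subsingleton _ L i, fun _ =>
      ⟨List.replicate n 0, by simp, ?_, ?_⟩⟩
    · intro r hr
      rw [List.eq_of_mem_replicate hr]
      exact Ideal.zero_mem _
    · exact isWeaklyRegular_replicate_zero L n
  · constructor
    · rintro ⟨rs, rfl, hmem, hreg⟩
      exact ModuleCat.subsingleton_ext_of_exists_isRegular (maximalIdeal R) _
        support_residue.subset (ModuleCat.of R L) (smul_top_lt_top L) rs hmem
        ((IsLocalRing.isRegular_iff_isWeaklyRegular_of_subset_maximalIdeal hmem).2 hreg)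
    · intro h
      obtain ⟨rs, h1, h2, h3⟩ := ModuleCat.exists_isRegular_of_exists_subsingleton_ext
        (maximalIdeal R) n (ModuleCat.of R L) (smul_top_lt_top L) _ support_residue h
      exact ⟨rs, h1, h2, h3.1⟩

theorem HasRegSeq.mono {L : Type u} [AddCommGroup L] [Module R L] [Module.Finite R L] {n k : ℕ}
    (h : HasRegSeq R L n) (hk : k ≤ n) : HasRegSeq R L k := by
  rw [hasRegSeq_iff_ext] at h ⊢
  exact fun i hi => h i (hi.trans_le hk)

/-- The depth lemma for the first module in a short exact sequence. -/
theorem HasRegSeq.of_exact_left {A B C : Type u} [AddCommGroup A] [Module R A] [Module.Finite R A]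
    [AddCommGroup B] [Module R B] [Module.Finite R B] [AddCommGroup C] [Module R C]
    [Module.Finite R C] {f : A →ₗ[R] B} {g : B →ₗ[R] C} (hf : Function.Injective f)
    (hg : Function.Surjective g) (hfg : Function.Exact f g) {n k : ℕ} (hB : HasRegSeq R B n)
    (hC : HasRegSeq R C k) : HasRegSeq R A (min n (k + 1)) := by
  rw [hasRegSeq_iff_ext] at *
  intro i hi
  rw [lt_min_iff] at hi
  let S : ShortComplex (ModuleCat.{u} R) := ShortComplex.mk (ModuleCat.ofHom f) (ModuleCat.ofHom g)
    (by ext x; exact hfg.apply_apply_eq_zero x)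
  have hS : S.ShortExact :=
    { exact := (ShortComplex.moduleCat_exact_iff S).2 fun x hx => (hfg x).1 hx
      mono_f := (ModuleCat.mono_iff_injective _).2 hf
      epi_g := (ModuleCat.epi_iff_surjective _).2 hg }
  rcases i with _ | i
  · have hB0 := hB 0 hi.1
    have : Function.Injective (fun e : Ext (ModuleCat.of R (R ⧸ maximalIdeal R)) S.X₁ 0 =>
        e.comp (Ext.mk₀ S.f) (add_zero 0)) := by
      have := hS.mono_f
      exact Ext.postcomp_mk₀_injective_of_mono (ModuleCat.of R (R ⧸ maximalIdeal R)) S.f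
    exact ⟨fun a b => this (Subsingleton.elim (h := hB0) _ _)⟩
  · have h1 := AddCommGrpCat.isZero_of_iff_subsingleton.mpr (hC i (by omega))
    have h2 := AddCommGrpCat.isZero_of_iff_subsingleton.mpr (hB (i + 1) hi.1)
    exact AddCommGrpCat.subsingleton_of_isZero <| ShortComplex.Exact.isZero_of_both_zeros
      (Ext.covariant_sequence_exact₁' (ModuleCat.of R (R ⧸ maximalIdeal R)) hS i (i + 1) rfl)
      (h1.eq_zero_of_src _) (h2.eq_zero_of_tgt _)

/-- Here x need not start the given regular sequence, so Ext is used; the generic element is such an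
x. -/
theorem HasRegSeq.quotSMulTop {L : Type u} [AddCommGroup L] [Module R L] [Module.Finite R L] {n : ℕ}
    (h : HasRegSeq R L (n + 1)) {x : R} (hx : IsSMulRegular L x) :
    HasRegSeq R (QuotSMulTop x L) n := by
  rw [hasRegSeq_iff_ext] at *
  intro i hi
  have zero1 := AddCommGrpCat.isZero_of_iff_subsingleton.mpr (h i (by omega))
  have zero2 := AddCommGrpCat.isZero_of_iff_subsingleton.mpr (h (i + 1) (by omega))
  exact AddCommGrpCat.subsingleton_of_isZero <| ShortComplex.Exact.isZero_of_both_zeros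
    ((Ext.covariant_sequence_exact₃' (ModuleCat.of R (R ⧸ maximalIdeal R))
      (IsSMulRegular.smulShortComplex_shortExact (M := ModuleCat.of R L) hx)) i (i + 1) rfl)
    (zero1.eq_zero_of_src _) (zero2.eq_zero_of_tgt _)

theorem HasRegSeq.genericExt {L : Type u} [AddCommGroup L] [Module R L] {n : ℕ}
    (h : HasRegSeq R L n) : HasRegSeq (GenericExt R) (GenericExt R ⊗[R] L) n := by
  obtain ⟨rs, h1, h2, h3⟩ := h
  refine ⟨rs.map (algebraMap R (GenericExt R)), by simpa, ?_,
    h3.of_flat_of_isBaseChange (TensorProduct.isBaseChange R L (GenericExt R))⟩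
  intro r hr
  obtain ⟨a, ha, rfl⟩ := List.mem_map.1 hr
  rw [maximalIdeal_genericExt]
  exact Ideal.mem_map_of_mem _ (h2 a ha)

end RegularSequences

/-! ### Existence, integrality and positivity of the multiplicity -/

section HilbertSamuel

open Filter Topology Asymptotics Pointwise

theorem tendsto_pow_succ_sub_div (n : ℕ) :
    Tendsto (fun j : ℕ => (((j : ℝ) + 1) ^ (n + 1) - (j : ℝ) ^ (n + 1)) / ((j : ℝ) + 1) ^ n) atTop
      (𝓝 (n + 1)) := by
  have h1 : Tendsto (fun j : ℕ => ∑ i ∈ Finset.range (n + 1), ((j : ℝ) / ((j : ℝ) + 1)) ^ (n - i))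
      atTop (𝓝 (∑ i ∈ Finset.range (n + 1), (1 : ℝ) ^ (n - i))) :=
    tendsto_finsetSum _ fun i _ => (tendsto_natCast_div_add_atTop (𝕜 := ℝ) 1).pow _
  simp only [one_pow, Finset.sum_const, Finset.card_range, nsmul_eq_mul, mul_one] at h1
  push_cast at h1
  refine h1.congr fun j => ?_
  have hj : ((j : ℝ) + 1) ≠ 0 := by positivity
  rw [← (Commute.all ((j : ℝ) + 1) (j : ℝ)).geom_sum₂_mul, add_sub_cancel_left, mul_one,
    Finset.sum_div]
  refine Finset.sum_congr rfl fun i hi => ?_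
  have hi' : i ≤ n := Nat.lt_succ_iff.1 (Finset.mem_range.1 hi)
  rw [Nat.add_sub_cancel, div_pow, div_eq_div_iff (pow_ne_zero _ hj) (pow_ne_zero _ hj)]
  have h2 : ((j : ℝ) + 1) ^ n = ((j : ℝ) + 1) ^ i * ((j : ℝ) + 1) ^ (n - i) := by
    rw [← pow_add, Nat.add_sub_cancel' hi']
  rw [h2]
  ring

/-- A Stolz-Cesàro argument: the increments of H are compared with those of j^(n+1), which grow like
(n+1) j^n; the factor n+1 turns n! into (n+1)!. -/
theorem tendsto_of_tendsto_sub {H G : ℕ → ℝ} {n : ℕ} {l : ℝ} {j1 : ℕ}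
    (hH : ∀ j ≥ j1, H (j + 1) = H j + G (j + 1))
    (hG : Tendsto (fun j => G j / (j : ℝ) ^ n) atTop (𝓝 (l / n.factorial))) :
    Tendsto (fun j => H j / (j : ℝ) ^ (n + 1)) atTop (𝓝 (l / (n + 1).factorial)) := by
  set c := l / ((n + 1).factorial : ℝ) with hc
  let g : ℕ → ℝ := fun j => ((j : ℝ) + 1) ^ (n + 1) - (j : ℝ) ^ (n + 1)
  have hgpos : ∀ j, 0 < g j := fun j => by
    simp only [g, sub_pos]
    exact pow_lt_pow_left₀ (by linarith) (by positivity) (Nat.succ_ne_zero n)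
  have hgsum : ∀ N, ∑ i ∈ Finset.range N, g i = (N : ℝ) ^ (n + 1) := fun N => by
    have := Finset.sum_range_sub (fun j : ℕ => (j : ℝ) ^ (n + 1)) N
    simpa [g] using this
  have h1 : Tendsto (fun j => (H (j + 1) - H j) / g j) atTop (𝓝 c) := by
    have h2 := ((hG.comp (tendsto_add_atTop_nat 1)).div (tendsto_pow_succ_sub_div n)
      (by positivity))
    have h3 : l / (n.factorial : ℝ) / (n + 1) = c := by
      rw [hc, Nat.factorial_succ]; push_cast; rw [div_div, mul_comm]
    rw [h3] at h2
    refine h2.congr' ?_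
    filter_upwards [eventually_ge_atTop j1] with j hj
    have hp : ((j : ℝ) + 1) ^ n ≠ 0 := by positivity
    have := (hgpos j).ne'
    simp only [Pi.div_apply, Function.comp_apply]
    rw [hH j hj]
    push_cast
    rw [add_sub_cancel_left, div_div_div_cancel_right₀ hp]
  have h4 : (fun j => (H (j + 1) - H j) - c * g j) =o[atTop] g := by
    rw [isLittleO_iff_tendsto (fun j h => absurd h (hgpos j).ne')]
    have := h1.sub_const c
    rw [sub_self] at this
    refine this.congr fun j => ?_
    have := (hgpos j).ne'
    field_simp
  have hs : ∀ N, ∑ i ∈ Finset.range N, (H (i + 1) - H i - c * g i) =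
      H N - H 0 - c * (N : ℝ) ^ (n + 1) := fun N => by
    rw [Finset.sum_sub_distrib, Finset.sum_range_sub, ← Finset.mul_sum, hgsum]
  have h5 := h4.sum_range (fun j => (hgpos j).le) (by
    simp only [hgsum]
    exact (tendsto_pow_atTop (Nat.succ_ne_zero n)).comp tendsto_natCast_atTop_atTop)
  simp only [hs, hgsum] at h5
  have h6 := h5.tendsto_div_nhds_zero
  have h7 : Tendsto (fun j : ℕ => H 0 / (j : ℝ) ^ (n + 1)) atTop (𝓝 0) :=
    Tendsto.div_atTop tendsto_const_nhds
      ((tendsto_pow_atTop (Nat.succ_ne_zero n)).comp tendsto_natCast_atTop_atTop)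
  have h8 := (h6.add h7).add_const c
  rw [add_zero, zero_add] at h8
  refine h8.congr' ?_
  filter_upwards [eventually_ge_atTop 1] with j hj
  have : (j : ℝ) ≠ 0 := by positivity
  field_simp
  ring

theorem supportDim_le_of_exact {R : Type*} [CommRing R] {A B C : Type*} [AddCommGroup A]
    [Module R A] [AddCommGroup B] [Module R B] [AddCommGroup C] [Module R C] {f : A →ₗ[R] B}
    {g : B →ₗ[R] C} (hf : Function.Injective f) (hg : Function.Surjective g)
    (hfg : Function.Exact f g) {k : WithBot ℕ∞} (hA : Module.supportDim R A ≤ k)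
    (hC : Module.supportDim R C ≤ k) : Module.supportDim R B ≤ k := by
  refine iSup_le fun p => ?_
  have hp := (Set.ext_iff.1 (Module.support_of_exact hfg hf hg) _).1 p.head.2
  rcases hp with hp | hp
  · refine le_trans ?_ hA
    have hmem : ∀ i, (p i : PrimeSpectrum R) ∈ Module.support R A := fun i =>
      Module.mem_support_mono (LTSeries.head_le p i) hp
    exact Order.LTSeries.length_le_krullDim
      (⟨p.length, fun i => ⟨p i, hmem i⟩, fun i => p.step i⟩ : LTSeries (Module.support R A))
  · refine le_trans ?_ hC
    have hmem : ∀ i, (p i : PrimeSpectrum R) ∈ Module.support R C := fun i =>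
      Module.mem_support_mono (LTSeries.head_le p i) hp
    exact Order.LTSeries.length_le_krullDim
      (⟨p.length, fun i => ⟨p i, hmem i⟩, fun i => p.step i⟩ : LTSeries (Module.support R C))

theorem isSMulRegular_quotient {R : Type*} [CommRing R] {p : Ideal R} (hp : p.IsPrime) {x : R} (hx : x ∉ p) :
    IsSMulRegular (R ⧸ p) x := by
  refine (injective_iff_map_eq_zero (LinearMap.lsmul R (R ⧸ p) x)).2 fun z hz => ?_
  obtain ⟨z, rfl⟩ := Ideal.Quotient.mk_surjective z
  rw [LinearMap.lsmul_apply, Algebra.smul_def, Ideal.Quotient.algebraMap_eq, ← map_mul,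
    Ideal.Quotient.eq_zero_iff_mem] at hz
  exact Ideal.Quotient.eq_zero_iff_mem.2 ((hp.mem_or_mem hz).resolve_left hx)

variable {R : Type u} [CommRing R] [IsLocalRing R] [IsNoetherianRing R]

theorem length_ne_top_of_supportDim_le_zero {L : Type*} [AddCommGroup L] [Module R L]
    [Module.Finite R L] (h : Module.supportDim R L ≤ 0) : Module.length R L ≠ ⊤ := by
  rcases subsingleton_or_nontrivial L with hL | hL
  · simp
  have h0 : Module.supportDim R L = 0 := by
    refine le_antisymm h ?_
    have := Module.supportDim_ne_bot_of_nontrivial R L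
    obtain ⟨d, hd⟩ := WithBot.ne_bot_iff_exists.1 this
    rw [← hd]
    exact WithBot.coe_le_coe.2 bot_le
  have hs := support_of_supportDim_eq_zero R L h0
  rw [Module.support_eq_zeroLocus, PrimeSpectrum.zeroLocus_eq_iff] at hs
  obtain ⟨k, hk⟩ := Ideal.exists_pow_le_of_le_radical_of_fg
    (hs ▸ Ideal.le_radical : maximalIdeal R ≤ (Module.annihilator R L).radical)
    (IsNoetherian.noetherian _)
  refine length_ne_top_of_pow_smul_eq_bot k L ?_
  rw [eq_bot_iff, Submodule.smul_le]
  intro r hr x _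
  exact (Submodule.mem_bot R).2 (Module.mem_annihilator.1 (hk hr) x)

theorem colength_quotSMulTop {L : Type*} [AddCommGroup L] [Module R L] {x : R}
    (hx : x ∈ maximalIdeal R) :
    colength (maximalIdeal R) (QuotSMulTop x L) = colength (maximalIdeal R) L := by
  have h := length_quotient_of_exact (LinearMap.lsmul R L x) (Submodule.mkQ (x • (⊤ : Submodule R L)))
    (Submodule.mkQ_surjective _) (by
      rw [LinearMap.exact_iff, Submodule.ker_mkQ]
      ext z
      simp [Submodule.mem_smul_pointwise_iff_exists]) (maximalIdeal R)
  have h2 : (maximalIdeal R • (⊤ : Submodule R L)).comap (LinearMap.lsmul R L x) = ⊤ :=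
    eq_top_iff.2 fun z _ => Submodule.smul_mem_smul hx Submodule.mem_top
  rw [h2, Module.length_eq_zero (M := L ⧸ (⊤ : Submodule R L)), zero_add] at h
  unfold colength
  rw [h]

/-- The conclusion of the Hilbert-Samuel theorem in dimension at most `n`. -/
def HilbertSamuelProp (R L : Type*) [CommRing R] [IsLocalRing R] [AddCommGroup L] [Module R L]
    (n : ℕ) : Prop :=
  ∃ e : ℕ, HasMult R L n e ∧ (Module.supportDim R L = n → 1 ≤ e) ∧
    (HasRegSeq R L n → colength (maximalIdeal R) L ≤ e)

theorem hilbertSamuel_zero (L : Type*) [AddCommGroup L] [Module R L] [Module.Finite R L]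
    (h : Module.supportDim R L ≤ 0) : HilbertSamuelProp R L 0 := by
  have hfin := length_ne_top_of_supportDim_le_zero h
  refine ⟨(Module.length R L).toNat, (hasMult_of_length_ne_top hfin).1, fun h0 => ?_, fun _ => ?_⟩
  · have : Nontrivial L := by
      rw [← Module.supportDim_ne_bot_iff_nontrivial R, h0]; simp
    rw [Nat.one_le_iff_ne_zero]
    intro h1
    rcases ENat.toNat_eq_zero.1 h1 with h2 | h2
    · exact Module.length_pos.ne' h2
    · exact hfin h2
  · exact ENat.toNat_le_toNat (Module.length_le_of_surjective _ (Submodule.mkQ_surjective _)) hfin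

/-- Replacing L by (R(X)⊗L)/y, with y generic, lowers dimension and depth by one and keeps the
multiplicity and the number of generators. The induction hypothesis must range over all rings
because R becomes R(X). -/
theorem hilbertSamuel_succ_of_isSMulRegular {n : ℕ}
    (ih : ∀ (S : Type u) [CommRing S] [IsLocalRing S] [IsNoetherianRing S] (L : Type u)
      [AddCommGroup L] [Module S L] [Module.Finite S L], Module.supportDim S L ≤ n →
        HilbertSamuelProp S L n)
    (L : Type u) [AddCommGroup L] [Module R L] [Module.Finite R L]
    (h : Module.supportDim R L ≤ (n + 1 : ℕ)) {x : R} (hx : x ∈ maximalIdeal R)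
    (hreg : IsSMulRegular L x) : HilbertSamuelProp R L (n + 1) := by
  obtain ⟨f, hf⟩ := Ideal.FG.exists_contentIdeal_eq (IsNoetherian.noetherian (maximalIdeal R))
  set y := algebraMap (Polynomial R) (GenericExt R) f
  have hy : y ∈ maximalIdeal (GenericExt R) := generic_mem_maximalIdeal hf
  have hyreg : IsSMulRegular (GenericExt R ⊗[R] L) y := generic_isSMulRegular hf hx hreg
  have hdim := Module.supportDim_quotSMulTop_succ_eq_supportDim (R := GenericExt R)
    (M := GenericExt R ⊗[R] L) (x := y) hyreg hy
  rw [supportDim_genericExt] at hdim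
  rw [← hdim] at h
  push_cast at h
  rw [ENat.WithBot.add_le_add_one_right_iff] at h
  obtain ⟨e, he1, he2, he3⟩ := ih (GenericExt R) _ h
  obtain ⟨j1, hj1⟩ := generic_colength_succ hf hx hreg
  refine ⟨e, ?_, fun hd => he2 ?_, fun hr => ?_⟩
  · refine tendsto_of_tendsto_sub (j1 := j1) (fun j hj => ?_) he1
    exact_mod_cast hj1 j hj
  · rw [← hdim] at hd
    push_cast at hd
    exact ENat.WithBot.add_one_cancel.1 hd
  · have := he3 (hr.genericExt.quotSMulTop hyreg)
    rw [colength_quotSMulTop hy] at this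
    have h1 := colength_genericExt (R := R) (L := L) 1
    rw [pow_one, pow_one] at h1
    rwa [h1] at this

theorem hilbertSamuel_succ {n : ℕ}
    (ih : ∀ (S : Type u) [CommRing S] [IsLocalRing S] [IsNoetherianRing S] (L : Type u)
      [AddCommGroup L] [Module S L] [Module.Finite S L], Module.supportDim S L ≤ n →
        HilbertSamuelProp S L n)
    (L : Type u) [AddCommGroup L] [Module R L] [hfin : Module.Finite R L]
    (h : Module.supportDim R L ≤ (n + 1 : ℕ)) : HilbertSamuelProp R L (n + 1) := by
  -- Without a regular element the depth bound is vacuous in degree n+1. The other two claims are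
  -- compatible with extensions and can be checked on the modules R/p, where any x outside p is
  -- regular.
  by_cases hreg : ∃ x ∈ maximalIdeal R, IsSMulRegular L x
  · obtain ⟨x, hx, hreg⟩ := hreg
    exact hilbertSamuel_succ_of_isSMulRegular ih L h hx hreg
  suffices H : ∃ e : ℕ, HasMult R L (n + 1) e ∧ (Module.supportDim R L = (n + 1 : ℕ) → 1 ≤ e) by
    obtain ⟨e, he1, he2⟩ := H
    refine ⟨e, he1, he2, fun ⟨rs, hlen, hmem, hrs⟩ => ?_⟩
    match rs with
    | [] => simp at hlen
    | a :: rs =>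
      rw [RingTheory.Sequence.isWeaklyRegular_cons_iff] at hrs
      exact absurd ⟨a, hmem a List.mem_cons_self, hrs.1⟩ hreg
  clear hreg
  induction hfin using IsNoetherianRing.induction_on_isQuotientEquivQuotientPrime R with
  | subsingleton N =>
    refine ⟨0, by simpa using hasMult_of_subsingleton (R := R) (A := N) (n + 1), fun hd => ?_⟩
    rw [Module.supportDim_eq_bot_of_subsingleton] at hd
    exact absurd hd.symm (WithBot.coe_ne_bot (a := ((n + 1 : ℕ) : ℕ∞)))
  | quotient N p e =>
    by_cases hp : maximalIdeal R ≤ p.1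
    · have hp' : p.1 = maximalIdeal R := ((maximalIdeal.isMaximal R).eq_of_le p.2.ne_top hp).symm
      have hd : Module.supportDim R N = 0 := by
        rw [Module.supportDim_eq_of_equiv e, Module.supportDim_quotient_eq_ringKrullDim, hp']
        let _ : Field (R ⧸ maximalIdeal R) := Ideal.Quotient.field _
        exact ringKrullDim_eq_zero_of_field _
      refine ⟨0, by simpa using (hasMult_of_length_ne_top
        (length_ne_top_of_supportDim_le_zero hd.le)).2 n, fun hd' => ?_⟩
      rw [hd] at hd'
      exact absurd (by exact_mod_cast hd' : 0 = n + 1) (by omega)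
    · obtain ⟨x, hx, hxp⟩ := SetLike.not_le_iff_exists.1 hp
      have hreg : IsSMulRegular N x := by
        rw [e.isSMulRegular_congr]
        exact isSMulRegular_quotient p.2 hxp
      obtain ⟨e, h1, h2, -⟩ := hilbertSamuel_succ_of_isSMulRegular ih N h hx hreg
      exact ⟨e, h1, h2⟩
  | exact N₁ N₂ N₃ f g hf hg hfg h₁ h₃ =>
    have hd₁ := Module.supportDim_le_of_injective f hf
    have hd₃ := Module.supportDim_le_of_surjective g hg
    obtain ⟨e₁, he₁, hp₁⟩ := h₁ (hd₁.trans h)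
    obtain ⟨e₃, he₃, hp₃⟩ := h₃ (hd₃.trans h)
    refine ⟨e₁ + e₃, by push_cast; exact HasMult.of_exact hf hg hfg he₁ he₃, fun hd => ?_⟩
    -- If e₁ + e₃ = 0, both outer terms have dimension at most n, hence so does the middle one.
    by_contra hlt
    have hne₁ : Module.supportDim R N₁ ≤ n := by
      refine ENat.WithBot.lt_add_one_iff.1 (lt_of_le_of_ne ?_ fun h' => hlt ?_)
      · exact_mod_cast hd₁.trans h
      · have := hp₁ (by exact_mod_cast h'); omega
    have hne₃ : Module.supportDim R N₃ ≤ n := by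
      refine ENat.WithBot.lt_add_one_iff.1 (lt_of_le_of_ne ?_ fun h' => hlt ?_)
      · exact_mod_cast hd₃.trans h
      · have := hp₃ (by exact_mod_cast h'); omega
    have := supportDim_le_of_exact hf hg hfg hne₁ hne₃
    rw [hd] at this
    exact absurd (by exact_mod_cast this : n + 1 ≤ n) (by omega)

/-- Existence, positivity and a lower bound for the multiplicity. -/
theorem hilbertSamuel (n : ℕ) : ∀ (R : Type u) [CommRing R] [IsLocalRing R] [IsNoetherianRing R]
    (L : Type u) [AddCommGroup L] [Module R L] [Module.Finite R L],
    Module.supportDim R L ≤ n → HilbertSamuelProp R L n := by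
  induction n with
  | zero => exact fun R _ _ _ L _ _ _ h => hilbertSamuel_zero L h
  | succ n ih => exact fun R _ _ _ L _ _ _ h => hilbertSamuel_succ ih L h

end HilbertSamuel

/-! ### Lengths of localizations -/

section LocalLength

variable {R : Type*} [CommRing R]

/-- The length of the localization of `L` at `p`. -/
noncomputable def localLength (p : PrimeSpectrum R) (L : Type*) [AddCommGroup L] [Module R L] : ℕ∞ :=
  Module.length (Localization p.asIdeal.primeCompl) (LocalizedModule p.asIdeal.primeCompl L)

variable {A B C : Type*} [AddCommGroup A] [Module R A] [AddCommGroup B] [Module R B]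
  [AddCommGroup C] [Module R C]

theorem localLength_of_exact (p : PrimeSpectrum R) {f : A →ₗ[R] B} {g : B →ₗ[R] C}
    (hf : Function.Injective f) (hg : Function.Surjective g) (hfg : Function.Exact f g) :
    localLength p B = localLength p A + localLength p C :=
  Module.length_eq_add_of_exact (LocalizedModule.map p.asIdeal.primeCompl f)
    (LocalizedModule.map p.asIdeal.primeCompl g) (LocalizedModule.map_injective _ f hf)
    (LocalizedModule.map_surjective _ g hg) (LocalizedModule.map_exact _ f g hfg)

theorem localLength_congr (p : PrimeSpectrum R) (e : A ≃ₗ[R] B) :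
    localLength p A = localLength p B :=
  (IsLocalizedModule.mapEquiv p.asIdeal.primeCompl
    (LocalizedModule.mkLinearMap p.asIdeal.primeCompl A)
    (LocalizedModule.mkLinearMap p.asIdeal.primeCompl B)
    (Localization p.asIdeal.primeCompl) e).length_eq

theorem localLength_eq_zero_iff (p : PrimeSpectrum R) :
    localLength p A = 0 ↔ p ∉ Module.support R A := by
  rw [localLength, Module.length_eq_zero_iff, Module.notMem_support_iff]

theorem localLength_quotient_self (p : PrimeSpectrum R) :
    localLength p (R ⧸ p.asIdeal) = 1 := by
  rw [localLength, Module.length_eq_one_iff, isSimpleModule_iff_toSpanSingleton_surjective]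
  constructor
  · rw [← Module.mem_support_iff, Module.mem_support_iff_of_finite, Ideal.annihilator_quotient]
  · intro x hx y
    induction x using LocalizedModule.induction_on with | _ a s
    induction y using LocalizedModule.induction_on with | _ b t
    obtain ⟨a, rfl⟩ := Ideal.Quotient.mk_surjective a
    obtain ⟨b, rfl⟩ := Ideal.Quotient.mk_surjective b
    have ha : a ∈ p.asIdeal.primeCompl := fun ha => hx (by
      rw [Ideal.Quotient.eq_zero_iff_mem.2 ha, LocalizedModule.zero_mk])
    refine ⟨Localization.mk (b * s) (t * ⟨a, ha⟩), ?_⟩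
    rw [LinearMap.toSpanSingleton_apply, LocalizedModule.mk_smul_mk, LocalizedModule.mk_eq]
    refine ⟨1, ?_⟩
    simp only [one_smul, Submonoid.smul_def, Submonoid.coe_mul]
    simp only [Algebra.smul_def, Ideal.Quotient.algebraMap_eq, ← map_mul]
    congr 1
    ring

end LocalLength

/-! ### Primes of maximal dimension, and associated primes versus depth -/

section Dimension

variable {R : Type u} [CommRing R] [IsLocalRing R] [IsNoetherianRing R]

theorem supportDim_quotient_le_of_mem_support {L : Type*} [AddCommGroup L] [Module R L]
    [Module.Finite R L] {p : PrimeSpectrum R} (hp : p ∈ Module.support R L) :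
    Module.supportDim R (R ⧸ p.asIdeal) ≤ Module.supportDim R L := by
  rw [Module.mem_support_iff_of_finite] at hp
  rw [Module.supportDim_eq_ringKrullDim_quotient_annihilator R L,
    ← Module.supportDim_quotient_eq_ringKrullDim]
  exact Module.supportDim_le_of_surjective (Submodule.factor hp) (Submodule.factor_surjective hp)

open Pointwise in
theorem supportDim_quotient_add_one_le {p q : Ideal R} (hp : p.IsPrime) (hq : q ≠ ⊤) (hpq : p < q) :
    Module.supportDim R (R ⧸ q) + 1 ≤ Module.supportDim R (R ⧸ p) := by
  obtain ⟨x, hxq, hxp⟩ := SetLike.exists_of_lt hpq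
  have hx : x ∈ maximalIdeal R := IsLocalRing.le_maximalIdeal hq hxq
  rw [← Module.supportDim_quotSMulTop_succ_eq_supportDim (isSMulRegular_quotient hp hxp) hx,
    ENat.WithBot.add_le_add_one_right_iff]
  have h1 : (x • (⊤ : Submodule R (R ⧸ p))) ≤ LinearMap.ker (Submodule.factor hpq.le) := by
    rintro _ ⟨z, -, rfl⟩
    obtain ⟨z, rfl⟩ := Ideal.Quotient.mk_surjective z
    change Submodule.factor hpq.le (x • Submodule.Quotient.mk z) = 0
    rw [← Submodule.Quotient.mk_smul, ← Submodule.mkQ_apply, Submodule.factor_mk]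
    exact (Submodule.Quotient.mk_eq_zero q).2 (Ideal.mul_mem_right _ _ hxq)
  refine Module.supportDim_le_of_surjective (Submodule.liftQ _ (Submodule.factor hpq.le) h1) ?_
  rw [← LinearMap.range_eq_top, Submodule.range_liftQ, LinearMap.range_eq_top]
  exact Submodule.factor_surjective hpq.le

theorem mem_minimalPrimes_annihilator_of_supportDim_le {L : Type*} [AddCommGroup L] [Module R L]
    [Module.Finite R L] {n : ℕ} (h : Module.supportDim R L ≤ n) {p : PrimeSpectrum R}
    (hp : p ∈ Module.support R L) (hpn : Module.supportDim R (R ⧸ p.asIdeal) = n) :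
    p.asIdeal ∈ (Module.annihilator R L).minimalPrimes := by
  refine ⟨⟨p.2, Module.mem_support_iff_of_finite.1 hp⟩, fun q hq hqp => ?_⟩
  by_contra hlt
  have h1 := supportDim_quotient_add_one_le hq.1 p.2.ne_top (lt_of_le_not_ge hqp hlt)
  have h2 := (supportDim_quotient_le_of_mem_support (p := ⟨q, hq.1⟩)
    (Module.mem_support_iff_of_finite.2 hq.2)).trans h
  rw [hpn] at h1
  exact absurd (by exact_mod_cast h1.trans h2 : n + 1 ≤ n) (by omega)

theorem finite_support_of_supportDim_le {L : Type*} [AddCommGroup L] [Module R L]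
    [Module.Finite R L] {n : ℕ} (h : Module.supportDim R L ≤ n) :
    {p ∈ Module.support R L | Module.supportDim R (R ⧸ p.asIdeal) = n}.Finite :=
  Set.Finite.of_injOn (f := PrimeSpectrum.asIdeal)
    (fun _ hp => mem_minimalPrimes_annihilator_of_supportDim_le h hp.1 hp.2)
    (fun _ _ _ _ => PrimeSpectrum.ext)
    (Ideal.finite_minimalPrimes_of_isNoetherianRing R (Module.annihilator R L))

open Pointwise in
/-- If `x` is `L`-regular and `p` is associated to `L`, some prime associated to `L / xL` contains
`p` and `x`. -/
theorem exists_mem_associatedPrimes_quotSMulTop {L : Type*} [AddCommGroup L] [Module R L]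
    [Module.Finite R L] {x : R} (hx : x ∈ maximalIdeal R) (hreg : IsSMulRegular L x) {p : Ideal R}
    (hp : p ∈ associatedPrimes R L) :
    ∃ q ∈ associatedPrimes R (QuotSMulTop x L), p ≤ q ∧ x ∈ q := by
  let K : Submodule R L := Submodule.torsionBySet R L p
  -- K is the part of L killed by p. Regularity of x gives K ∩ xL = xK, so by Nakayama K is not
  -- contained in xL; an associated prime of its nonzero image in L/xL contains both p and x.
  have hK : K ≠ ⊥ := by
    obtain ⟨hp', f, hf⟩ := (isAssociatedPrime_iff_exists_injective_linearMap _ _).1 hp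
    intro h
    have h1 : f 1 ∈ K := by
      rw [Submodule.mem_torsionBySet_iff]
      intro a
      rw [← map_smul, Algebra.smul_def, mul_one, Ideal.Quotient.algebraMap_eq,
        Ideal.Quotient.eq_zero_iff_mem.2 a.2, map_zero]
    rw [h, Submodule.mem_bot, map_eq_zero_iff f hf] at h1
    exact one_ne_zero h1
  let Q : Submodule R (QuotSMulTop x L) := K.map (Submodule.mkQ (x • (⊤ : Submodule R L)))
  have hQ : Nontrivial Q := by
    rw [Submodule.nontrivial_iff_ne_bot]
    intro h
    apply hK
    refine Submodule.eq_bot_of_le_smul_of_le_jacobson_bot (maximalIdeal R) K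
      (IsNoetherian.noetherian K) (fun z hz => ?_) (IsLocalRing.maximalIdeal_le_jacobson _)
    have h1 : Submodule.mkQ (x • (⊤ : Submodule R L)) z ∈ Q := ⟨z, hz, rfl⟩
    rw [h, Submodule.mem_bot, Submodule.mkQ_apply, Submodule.Quotient.mk_eq_zero] at h1
    obtain ⟨w, -, rfl⟩ := h1
    refine Submodule.smul_mem_smul hx ?_
    change x • w ∈ K at hz
    rw [Submodule.mem_torsionBySet_iff] at hz ⊢
    intro a
    have := hz a
    rw [smul_comm] at this
    exact hreg.right_eq_zero_of_smul this
  obtain ⟨q, hq⟩ := associatedPrimes.nonempty R Q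
  refine ⟨q, associatedPrimes.subset_of_injective Q.injective_subtype hq, ?_⟩
  have hle : ∀ a, (∀ z ∈ K, a • z ∈ x • (⊤ : Submodule R L)) → a ∈ q := fun a ha => by
    refine IsAssociatedPrime.annihilator_le hq (Submodule.mem_annihilator.2 ?_)
    rintro ⟨_, z, hz, rfl⟩ -
    refine Subtype.ext ?_
    change a • Submodule.mkQ (x • (⊤ : Submodule R L)) z = 0
    rw [← map_smul, Submodule.mkQ_apply, Submodule.Quotient.mk_eq_zero]
    exact ha z hz
  refine ⟨fun a ha => hle a fun z hz => ?_, hle x fun z _ => ⟨z, trivial, rfl⟩⟩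
  rw [(Submodule.mem_torsionBySet_iff _ _).1 hz ⟨a, ha⟩]
  exact zero_mem _

/-- The depth of `L` is at most the dimension of `R / p` for each associated prime `p` of `L`. -/
theorem HasRegSeq.le_supportDim_quotient {n : ℕ} : ∀ {L : Type u} [AddCommGroup L] [Module R L]
    [Module.Finite R L], HasRegSeq R L n → ∀ {p : Ideal R}, p ∈ associatedPrimes R L →
      (n : WithBot ℕ∞) ≤ Module.supportDim R (R ⧸ p) := by
  induction n with
  | zero =>
    intro L _ _ _ _ p hp
    have : Nontrivial (R ⧸ p) := Ideal.Quotient.nontrivial_iff.2 hp.1.ne_top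
    obtain ⟨d, hd⟩ := WithBot.ne_bot_iff_exists.1 (Module.supportDim_ne_bot_of_nontrivial R (R ⧸ p))
    rw [← hd]
    exact WithBot.coe_le_coe.2 (by simp)
  | succ n ih =>
    intro L _ _ _ h p hp
    obtain ⟨rs, hlen, hmem, hrs⟩ := h
    match rs with
    | [] => simp at hlen
    | a :: rs =>
      have ha := hmem a List.mem_cons_self
      have hreg := ((RingTheory.Sequence.isWeaklyRegular_cons_iff _ _ _).1 hrs).1
      obtain ⟨q, hq, hpq, haq⟩ := exists_mem_associatedPrimes_quotSMulTop ha hreg hp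
      have h1 := ih (HasRegSeq.quotSMulTop ⟨_, hlen, hmem, hrs⟩ hreg) hq
      -- Associated primes consist of zerodivisors, so q contains p strictly and the dimension drops
      -- by at least one.
      have hap : a ∉ p := fun hap => by
        have : a ∈ ⋃ p ∈ associatedPrimes R L, (p : Set R) := Set.mem_biUnion hp hap
        rw [biUnion_associatedPrimes_eq_compl_regular] at this
        exact this hreg
      have h2 := supportDim_quotient_add_one_le hp.1 hq.1.ne_top
        (lt_of_le_of_ne hpq fun h => hap (h ▸ haq))
      refine le_trans ?_ h2
      push_cast
      gcongr

end Dimension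

/-! ### The associativity formula -/

section Associativity

variable {R : Type u} [CommRing R] [IsLocalRing R] [IsNoetherianRing R] {n : ℕ}

theorem hasMult_zero_of_supportDim_lt (L : Type u) [AddCommGroup L] [Module R L]
    [Module.Finite R L] (h : Module.supportDim R L < n) : HasMult R L n 0 := by
  rcases n with _ | n
  · have h1 : Module.supportDim R L = ⊥ := by
      by_contra hne
      obtain ⟨d, hd⟩ := WithBot.ne_bot_iff_exists.1 hne
      rw [← hd] at h
      exact absurd (WithBot.coe_lt_coe.1 h) (by simp)
    have := (Module.supportDim_eq_bot_iff_subsingleton _ _).1 h1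
    exact hasMult_of_subsingleton 0
  · have h1 : Module.supportDim R L ≤ n := ENat.WithBot.lt_add_one_iff.1 (by exact_mod_cast h)
    obtain ⟨e, he, -⟩ := hilbertSamuel n R L h1
    have h2 := he.mul (tendsto_one_div_atTop_nhds_zero_nat (𝕜 := ℝ))
    unfold HasMult
    rw [mul_zero] at h2
    rw [zero_div]
    refine h2.congr fun j => ?_
    rw [div_mul_div_comm, mul_one, pow_succ]

/-- The associativity formula for multiplicities. -/
theorem hasMult_sum_localLength {E : PrimeSpectrum R → ℝ} {T : Finset (PrimeSpectrum R)}
    (hE : ∀ p ∈ T, HasMult R (R ⧸ p.asIdeal) n (E p))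
    (hT : ∀ p ∈ T, Module.supportDim R (R ⧸ p.asIdeal) = n)
    (L : Type u) [AddCommGroup L] [Module R L] [hfin : Module.Finite R L]
    (hL : Module.supportDim R L ≤ n)
    (hTL : ∀ p ∈ Module.support R L, Module.supportDim R (R ⧸ p.asIdeal) = n → p ∈ T) :
    (∀ p ∈ T, localLength p L ≠ ⊤) ∧
      HasMult R L n (∑ p ∈ T, (localLength p L).toNat * E p) := by
  induction hfin using IsNoetherianRing.induction_on_isQuotientEquivQuotientPrime R with
  | subsingleton N =>
    have h0 : ∀ p : PrimeSpectrum R, localLength p N = 0 := fun p =>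
      (localLength_eq_zero_iff p).2 (by simp [Module.support_eq_empty])
    exact ⟨fun p _ => by simp [h0], by simpa [h0] using hasMult_of_subsingleton n⟩
  | quotient N q e =>
    have hsupp : ∀ p : PrimeSpectrum R, p ∈ Module.support R N ↔ q.asIdeal ≤ p.asIdeal := fun p => by
      rw [e.support_eq, Module.mem_support_iff_of_finite, Ideal.annihilator_quotient]
    -- A prime of T strictly above q would force dim R/q ≥ n+1.
    have h0 : ∀ p ∈ T, p ≠ q → localLength p N = 0 := fun p hp hpq => by
      rw [localLength_eq_zero_iff, hsupp]
      intro hle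
      have h1 := supportDim_quotient_add_one_le q.2 p.2.ne_top
        (lt_of_le_of_ne hle fun h => hpq (PrimeSpectrum.ext h.symm))
      rw [← Module.supportDim_eq_of_equiv e, hT p hp] at h1
      exact absurd (by exact_mod_cast h1.trans hL : n + 1 ≤ n) (by omega)
    have h1 : localLength q N = 1 := (localLength_congr q e).trans (localLength_quotient_self q)
    refine ⟨fun p hp => ?_, ?_⟩
    · rcases eq_or_ne p q with rfl | hpq
      · simp [h1]
      · simp [h0 p hp hpq]
    · by_cases hq : q ∈ T
      · rw [Finset.sum_eq_single_of_mem q hq fun p hp hpq => by simp [h0 p hp hpq], h1]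
        simpa using (hE q hq).congr e.symm
      · rw [Finset.sum_eq_zero fun p hp => by
          rw [h0 p hp (fun h => hq (h ▸ hp))]; simp]
        refine hasMult_zero_of_supportDim_lt N (lt_of_le_of_ne hL fun h => hq ?_)
        exact hTL q ((hsupp q).2 le_rfl) (by rw [← Module.supportDim_eq_of_equiv e, h])
  | exact N₁ N₂ N₃ f g hf hg hfg h₁ h₃ =>
    have hs := Module.support_of_exact hfg hf hg
    obtain ⟨a₁, b₁⟩ := h₁ ((Module.supportDim_le_of_injective f hf).trans hL)
      fun p hp => hTL p (hs ▸ Or.inl hp)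
    obtain ⟨a₃, b₃⟩ := h₃ ((Module.supportDim_le_of_surjective g hg).trans hL)
      fun p hp => hTL p (hs ▸ Or.inr hp)
    have hl := fun p => localLength_of_exact p hf hg hfg
    refine ⟨fun p hp => by rw [hl]; exact WithTop.add_ne_top.2 ⟨a₁ p hp, a₃ p hp⟩, ?_⟩
    have h2 := HasMult.of_exact hf hg hfg b₁ b₃
    rw [← Finset.sum_add_distrib] at h2
    convert h2 using 2 with p hp
    rw [hl, ENat.toNat_add (a₁ p hp) (a₃ p hp)]
    push_cast
    ring

/-- By associativity the multiplicity depends only on local lengths at primes with dim R/p = n, so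
proportional lengths give proportional multiplicities. -/
theorem HasMult.of_localLength_eq {L L' : Type u} [AddCommGroup L] [Module R L] [Module.Finite R L]
    [AddCommGroup L'] [Module R L'] [Module.Finite R L'] (hL : Module.supportDim R L ≤ n)
    (hL' : Module.supportDim R L' ≤ n) {a : ℕ}
    (h : ∀ p : PrimeSpectrum R, Module.supportDim R (R ⧸ p.asIdeal) = n →
      localLength p L = a * localLength p L') {e : ℝ} (he : HasMult R L' n e) :
    HasMult R L n (a * e) := by
  classical
  -- The union lets both associativity sums run over the same primes; extra primes contribute length
  -- zero.
  let T := (finite_support_of_supportDim_le hL).toFinset ∪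
    (finite_support_of_supportDim_le hL').toFinset
  have hT : ∀ p ∈ T, Module.supportDim R (R ⧸ p.asIdeal) = n := fun p hp => by
    simp only [T, Finset.mem_union, Set.Finite.mem_toFinset] at hp
    rcases hp with hp | hp <;> exact hp.2
  have hE : ∀ p : PrimeSpectrum R, ∃ E : ℝ, p ∈ T → HasMult R (R ⧸ p.asIdeal) n E := fun p => by
    by_cases hp : p ∈ T
    · obtain ⟨e, he, -⟩ := hilbertSamuel n R (R ⧸ p.asIdeal) (hT p hp).le
      exact ⟨e, fun _ => he⟩
    · exact ⟨0, fun h => absurd h hp⟩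
  choose E hE using hE
  obtain ⟨-, h1⟩ := hasMult_sum_localLength hE hT L hL fun p hp hpn => by
    simp only [T, Finset.mem_union, Set.Finite.mem_toFinset]
    exact Or.inl ⟨hp, hpn⟩
  obtain ⟨-, h2⟩ := hasMult_sum_localLength hE hT L' hL' fun p hp hpn => by
    simp only [T, Finset.mem_union, Set.Finite.mem_toFinset]
    exact Or.inr ⟨hp, hpn⟩
  rw [he.unique h2, Finset.mul_sum]
  convert h1 using 2 with p hp
  rw [h p (hT p hp), ENat.toNat_mul]
  push_cast
  rw [ENat.toNat_natCast]
  ring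

end Associativity

noncomputable section

/-! ### Minimal covers and syzygies -/

section Covers

variable (R : Type u) [CommRing R] (N : Type u) [AddCommGroup N] [Module R N]

/-- The free module covering the `i`-th syzygy of `N` in its minimal free resolution. -/
abbrev resolutionTerm (i : ℕ) : Type u := (⊤ : Submodule R (syzygy R N i)).generators →₀ R

/-- The inclusion of a syzygy in the previous term of the minimal free resolution. -/
def syzygyInclusion (i : ℕ) : syzygy R N (i + 1) →ₗ[R] resolutionTerm R N i :=
  (LinearMap.ker (minimalCover R (syzygy R N i))).subtype

theorem syzygyInclusion_injective (i : ℕ) : Function.Injective (syzygyInclusion R N i) :=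
  Subtype.val_injective

theorem minimalCover_surjective : Function.Surjective (minimalCover R N) := by
  rw [← LinearMap.range_eq_top, minimalCover, Finsupp.range_linearCombination,
    Subtype.range_coe_subtype, Set.ofPred_mem_eq, Submodule.span_generators]

theorem syzygy_exact (i : ℕ) :
    Function.Exact (syzygyInclusion R N i) (minimalCover R (syzygy R N i)) :=
  LinearMap.exact_subtype_ker_map _

variable [Module.Finite R N]

instance finite_generators : Finite (⊤ : Submodule R N).generators :=
  (Submodule.FG.finite_generators Module.Finite.fg_top).to_subtype

instance finite_syzygy [IsNoetherianRing R] (i : ℕ) : Module.Finite R (syzygy R N i) := by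
  induction i with
  | zero => exact inferInstanceAs (Module.Finite R N)
  | succ i ih =>
    exact inferInstanceAs (Module.Finite R (LinearMap.ker (minimalCover R (syzygy R N i))))

/-- The coefficients of a relation between minimal generators lie in the maximal ideal. -/
theorem mem_maximalIdeal_of_linearCombination_eq_zero {R : Type*} [CommRing R] [IsLocalRing R]
    {N : Type*} [AddCommGroup N] [Module R N] {G : Set N} (hfin : G.Finite)
    (hG : Submodule.span R G = ⊤) (hcard : G.ncard = (⊤ : Submodule R N).spanFinrank) {a : G →₀ R}
    (ha : Finsupp.linearCombination R (fun g : G => (g : N)) a = 0) (g : G) :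
    a g ∈ maximalIdeal R := by
  classical
  by_contra hg
  rw [IsLocalRing.mem_maximalIdeal, mem_nonunits_iff, not_not] at hg
  -- A unit coefficient would express g through the other generators, against minimality of their
  -- number.
  have hmem : (g : N) ∈ Submodule.span R (G \ {(g : N)}) := by
    have h1 : Finsupp.linearCombination R (fun g : G => (g : N)) (Finsupp.single g (a g)) +
        Finsupp.linearCombination R (fun g : G => (g : N)) (a.erase g) = 0 := by
      rw [← map_add, Finsupp.single_add_erase]
      exact ha
    rw [Finsupp.linearCombination_single] at h1
    have h2 : Finsupp.linearCombination R (fun g : G => (g : N)) (a.erase g) ∈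
        Submodule.span R (G \ {(g : N)}) := by
      rw [Finsupp.linearCombination_apply]
      refine Submodule.sum_mem _ fun k hk => Submodule.smul_mem _ _ (Submodule.subset_span ?_)
      refine ⟨k.2, fun h => ?_⟩
      rw [Finsupp.support_erase, Finset.mem_erase] at hk
      exact hk.1 (Subtype.ext h)
    rw [← Submodule.smul_mem_iff_of_isUnit _ hg, eq_neg_of_add_eq_zero_left h1]
    exact neg_mem h2
  have hspan : Submodule.span R (G \ {(g : N)}) = ⊤ := by
    rw [eq_top_iff, ← hG, Submodule.span_le]
    intro k hk
    by_cases hkg : k = g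
    · rw [hkg]; exact hmem
    · exact Submodule.subset_span ⟨hk, hkg⟩
  have h3 := Submodule.spanFinrank_span_le_ncard_of_finite (R := R) (hfin.sdiff (t := {(g : N)}))
  rw [hspan, ← hcard] at h3
  exact absurd h3 (not_le.2 (Set.ncard_sdiff_singleton_lt_of_mem g.2 hfin))

theorem ker_minimalCover_le [IsLocalRing R] :
    LinearMap.ker (minimalCover R N) ≤
      maximalIdeal R • (⊤ : Submodule R ((⊤ : Submodule R N).generators →₀ R)) := by
  intro a ha
  have hcoord : ∀ g, a g ∈ maximalIdeal R := fun g =>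
    mem_maximalIdeal_of_linearCombination_eq_zero
      (Submodule.FG.finite_generators Module.Finite.fg_top) (Submodule.span_generators _)
      (Submodule.FG.generators_ncard Module.Finite.fg_top) ha g
  rw [← Finsupp.sum_single a]
  refine Submodule.sum_mem _ fun g _ => ?_
  rw [← mul_one (a g), ← smul_eq_mul, ← Finsupp.smul_single]
  exact Submodule.smul_mem_smul (hcoord g) trivial

end Covers

/-! ### Numbers of generators and dimensions of tensor products -/

section Colength

variable {R : Type u} [CommRing R] {M : Type*} [AddCommGroup M] [Module R M]

theorem colength_tensorProduct_free (I : Ideal R) (ι : Type*) [Finite ι] :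
    colength I (M ⊗[R] (ι →₀ R)) = Nat.card ι * colength I M := by
  classical
  unfold colength
  let e : ((M ⊗[R] (ι →₀ R)) ⧸ (I • (⊤ : Submodule R (M ⊗[R] (ι →₀ R))))) ≃ₗ[R]
      (ι →₀ (M ⧸ (I • (⊤ : Submodule R M)))) :=
    (TensorProduct.quotTensorEquivQuotSMul (M ⊗[R] (ι →₀ R)) I).symm ≪≫ₗ
      (TensorProduct.assoc R (R ⧸ I) M (ι →₀ R)).symm ≪≫ₗ
      TensorProduct.finsuppScalarRight R R ((R ⧸ I) ⊗[R] M) ι ≪≫ₗ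
      Finsupp.mapRange.linearEquiv (TensorProduct.quotTensorEquivQuotSMul M I)
  rw [e.length_eq, Module.length_finsupp, ENat.toNat_mul, ENat.card_eq_coe_natCard,
    ENat.toNat_natCast]

theorem HasMult.tensorProduct_free [IsLocalRing R] {n : ℕ} {e : ℝ} (h : HasMult R M n e)
    (ι : Type*) [Finite ι] : HasMult R (M ⊗[R] (ι →₀ R)) n (Nat.card ι * e) := by
  unfold HasMult at *
  rw [mul_div_assoc]
  refine (h.const_mul (Nat.card ι : ℝ)).congr fun j => ?_
  rw [colength_tensorProduct_free]
  push_cast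
  ring

theorem colength_eq_of_surjective [IsLocalRing R] [IsNoetherianRing R] {M' : Type*} [AddCommGroup M'] [Module R M'] (I : Ideal R)
    (g : M →ₗ[R] M') (hg : Function.Surjective g)
    (hker : LinearMap.ker g ≤ I • (⊤ : Submodule R M)) : colength I M = colength I M' := by
  have h := length_quotient_of_exact (LinearMap.ker g).subtype g hg
    (LinearMap.exact_subtype_ker_map g) I
  have h2 : (I • (⊤ : Submodule R M)).comap (LinearMap.ker g).subtype = ⊤ :=
    eq_top_iff.2 fun z _ => hker z.2
  rw [h2, Module.length_eq_zero (M := LinearMap.ker g ⧸ (⊤ : Submodule R (LinearMap.ker g))),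
    zero_add] at h
  unfold colength
  rw [h]

/-- The minimal cover F → N has kernel in mF, so M⊗F → M⊗N is an isomorphism modulo m. -/
theorem colength_tensorProduct [IsLocalRing R] [IsNoetherianRing R] (N : Type u) [AddCommGroup N]
    [Module R N] [Module.Finite R N] :
    colength (maximalIdeal R) (M ⊗[R] N) =
      Nat.card (⊤ : Submodule R N).generators * colength (maximalIdeal R) M := by
  rw [← colength_tensorProduct_free]
  refine (colength_eq_of_surjective _ ((minimalCover R N).lTensor M)
    (LinearMap.lTensor_surjective _ (minimalCover_surjective R N)) ?_).symm
  rw [(lTensor_exact M (LinearMap.exact_subtype_ker_map _)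
    (minimalCover_surjective R N)).linearMap_ker_eq]
  rintro _ ⟨z, rfl⟩
  induction z using TensorProduct.induction_on with
  | zero => simp
  | add x y hx hy => rw [map_add]; exact add_mem hx hy
  | tmul x y =>
    rw [LinearMap.lTensor_tmul, Submodule.subtype_apply]
    generalize (y : (⊤ : Submodule R N).generators →₀ R) = y', ker_minimalCover_le R N y.2 = hy
    induction hy using Submodule.smul_induction_on' with
    | smul r hr w hw =>
      rw [TensorProduct.tmul_smul]
      exact Submodule.smul_mem_smul hr trivial
    | add a ha b hb h1 h2 => rw [TensorProduct.tmul_add]; exact add_mem h1 h2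

theorem annihilator_le_annihilator_tensorProduct {N : Type*} [AddCommGroup N] [Module R N] :
    Module.annihilator R M ≤ Module.annihilator R (M ⊗[R] N) := by
  intro a ha
  rw [Module.mem_annihilator] at ha ⊢
  intro z
  induction z using TensorProduct.induction_on with
  | zero => simp
  | add x y hx hy => rw [smul_add, hx, hy, add_zero]
  | tmul x y => rw [TensorProduct.smul_tmul', ha, TensorProduct.zero_tmul]

theorem supportDim_tensorProduct_le {N : Type*} [AddCommGroup N] [Module R N] [Module.Finite R M]
    [Module.Finite R N] : Module.supportDim R (M ⊗[R] N) ≤ Module.supportDim R M := by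
  rw [Module.supportDim_eq_ringKrullDim_quotient_annihilator R M,
    Module.supportDim_eq_ringKrullDim_quotient_annihilator]
  exact ringKrullDim_le_of_surjective
    (Ideal.Quotient.factor annihilator_le_annihilator_tensorProduct)
    (Ideal.Quotient.factor_surjective _)

end Colength

/-! ### The minimal free resolution and Tor -/

section Resolution

variable (R : Type u) [CommRing R] (N : Type u) [AddCommGroup N] [Module R N]

/-- The differentials of the minimal free resolution. -/
def resolutionD (i : ℕ) : resolutionTerm R N (i + 1) →ₗ[R] resolutionTerm R N i :=
  syzygyInclusion R N i ∘ₗ minimalCover R (syzygy R N (i + 1))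

theorem resolutionD_comp (i : ℕ) : resolutionD R N i ∘ₗ resolutionD R N (i + 1) = 0 := by
  ext1 x
  refine LinearMap.ext fun y => ?_
  simp only [resolutionD, LinearMap.comp_apply, LinearMap.zero_apply]
  rw [(syzygy_exact R N (i + 1)).apply_apply_eq_zero, map_zero]

theorem exact_resolutionD (i : ℕ) :
    Function.Exact (resolutionD R N (i + 1)) (resolutionD R N i) := by
  intro x
  simp only [resolutionD, LinearMap.comp_apply,
    map_eq_zero_iff _ (syzygyInclusion_injective R N i)]
  rw [syzygy_exact R N (i + 1) x, LinearMap.coe_comp,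
    (minimalCover_surjective R (syzygy R N (i + 2))).range_comp]

theorem exact_resolutionD_zero :
    Function.Exact (resolutionD R N 0) (minimalCover R (syzygy R N 0)) := by
  intro x
  rw [syzygy_exact R N 0 x, resolutionD, LinearMap.coe_comp,
    (minimalCover_surjective R (syzygy R N 1)).range_comp]

/-- The minimal free resolution as a chain complex. -/
def resolutionComplex : ChainComplex (ModuleCat.{u} R) ℕ :=
  ChainComplex.of (fun i => ModuleCat.of R (resolutionTerm R N i))
    (fun i => ModuleCat.ofHom (resolutionD R N i)) fun i => by
      rw [← ModuleCat.ofHom_comp, resolutionD_comp]; rfl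

theorem resolutionComplex_d (i : ℕ) :
    (resolutionComplex R N).d (i + 1) i = ModuleCat.ofHom (resolutionD R N i) := by
  unfold resolutionComplex
  exact ChainComplex.of_d (fun i => ModuleCat.of R (resolutionTerm R N i))
    (fun i => ModuleCat.ofHom (resolutionD R N i)) i

theorem resolutionComplex_exactAt (i : ℕ) : (resolutionComplex R N).ExactAt (i + 1) := by
  rw [HomologicalComplex.exactAt_iff' _ (i + 2) (i + 1) i (by simp) (by simp),
    ShortComplex.moduleCat_exact_iff]
  intro x hx
  change (resolutionComplex R N).d (i + 1) i x = 0 at hx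
  change ∃ y, (resolutionComplex R N).d (i + 2) (i + 1) y = x
  rw [resolutionComplex_d] at hx
  rw [resolutionComplex_d]
  exact (exact_resolutionD R N i x).1 hx

/-- The augmentation of the minimal free resolution. -/
def resolutionAugmentation :
    resolutionComplex R N ⟶ (ChainComplex.single₀ (ModuleCat.{u} R)).obj (ModuleCat.of R N) :=
  (ChainComplex.toSingle₀Equiv _ _).symm ⟨ModuleCat.ofHom (minimalCover R (syzygy R N 0)), by
    rw [resolutionComplex_d]
    ext1
    exact (exact_resolutionD_zero R N).linearMap_comp_eq_zero⟩

theorem resolutionAugmentation_f_zero : (resolutionAugmentation R N).f 0 =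
    ModuleCat.ofHom (minimalCover R (syzygy R N 0)) :=
  ChainComplex.toSingle₀Equiv_symm_apply_f_zero _ _

/-- The minimal free resolution as a projective resolution. -/
def minimalResolution : ProjectiveResolution (ModuleCat.of R N) where
  complex := resolutionComplex R N
  projective i := by
    have : Module.Projective R (resolutionTerm R N i) := inferInstance
    exact (IsProjective.iff_projective (R := R) (resolutionTerm R N i)).1 this
  π := resolutionAugmentation R N
  quasiIso := ⟨fun n => by
    cases n
    · rw [ChainComplex.quasiIsoAt₀_iff, ShortComplex.quasiIso_iff_of_zeros']
      · let S : ShortComplex (ModuleCat.{u} R) := ShortComplex.mk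
          (ModuleCat.ofHom (resolutionD R N 0)) (ModuleCat.ofHom (minimalCover R (syzygy R N 0)))
          (by ext1; exact (exact_resolutionD_zero R N).linearMap_comp_eq_zero)
        refine (ShortComplex.exact_and_epi_g_iff_of_iso (S₂ := S) ?_).2 ⟨?_, ?_⟩
        · exact ShortComplex.isoMk (Iso.refl _) (Iso.refl _) (Iso.refl _)
            ((Category.id_comp _).trans
              ((resolutionComplex_d R N 0).symm.trans (Category.comp_id _).symm))
            ((Category.id_comp _).trans ((resolutionAugmentation_f_zero R N).symm.trans
              (Category.comp_id _).symm))
        · exact (ShortComplex.moduleCat_exact_iff S).2 fun x hx => (exact_resolutionD_zero R N x).1 hx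
        · exact (ModuleCat.epi_iff_surjective _).2 (minimalCover_surjective R _)
      all_goals rfl
    · rw [quasiIsoAt_iff_exactAt']
      · apply resolutionComplex_exactAt
      · apply ChainComplex.exactAt_succ_single_obj⟩

variable {R N}

/-- If `Tor_{i + 1}(M, N)` vanishes, tensoring the inclusion `Ω^(i + 1) N → F_i` with `M` gives an
injection. -/
theorem lTensor_syzygyInclusion_injective (M : Type u) [AddCommGroup M] [Module R M] (i : ℕ)
    (h : Limits.IsZero
      (((Tor (ModuleCat.{u} R) (i + 1)).obj (ModuleCat.of R M)).obj (ModuleCat.of R N))) :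
    Function.Injective ((syzygyInclusion R N i).lTensor M) := by
  have h1 := h.of_iso ((minimalResolution R N).isoLeftDerivedObj
    ((MonoidalCategory.tensoringLeft (ModuleCat.{u} R)).obj (ModuleCat.of R M)) (i + 1)).symm
  have h2 := (HomologicalComplex.exactAt_iff_isZero_homology _ _).2 h1
  rw [HomologicalComplex.exactAt_iff' _ (i + 2) (i + 1) i (by simp) (by simp),
    ShortComplex.moduleCat_exact_iff] at h2
  have h3 : ∀ x : M ⊗[R] resolutionTerm R N (i + 1), (resolutionD R N i).lTensor M x = 0 →
      ∃ y, (resolutionD R N (i + 1)).lTensor M y = x := by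
    intro x hx
    obtain ⟨y, hy⟩ := h2 x (by
      change (((MonoidalCategory.tensoringLeft (ModuleCat.{u} R)).obj (ModuleCat.of R M)).map
        ((resolutionComplex R N).d (i + 1) i)).hom x = 0
      rw [resolutionComplex_d]
      exact hx)
    refine ⟨y, ?_⟩
    change (((MonoidalCategory.tensoringLeft (ModuleCat.{u} R)).obj (ModuleCat.of R M)).map
        ((resolutionComplex R N).d (i + 2) (i + 1))).hom y = x at hy
    rw [resolutionComplex_d] at hy
    exact hy
  rw [injective_iff_map_eq_zero]
  intro w hw
  -- Lift w to M⊗F_(i+1). The lift is a cycle, hence a boundary from M⊗F_(i+2), and boundaries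
  -- vanish in M⊗Ω^(i+1)N.
  obtain ⟨x, rfl⟩ := LinearMap.lTensor_surjective M (minimalCover_surjective R (syzygy R N (i + 1))) w
  obtain ⟨y, rfl⟩ := h3 x (by rw [resolutionD, LinearMap.lTensor_comp]; exact hw)
  rw [← LinearMap.comp_apply, ← LinearMap.lTensor_comp, resolutionD, ← LinearMap.comp_assoc,
    (syzygy_exact R N (i + 1)).linearMap_comp_eq_zero]
  simp

theorem hasProjectiveDimensionLT_of_syzygy (i k : ℕ)
    (h : HasProjectiveDimensionLT (syzygy R N i) k) :
    HasProjectiveDimensionLT (ModuleCat.of R N) (i + k) := by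
  induction i generalizing k with
  | zero => rw [zero_add]; exact h
  | succ i ih =>
    rw [Nat.succ_add_eq_add_succ]
    refine ih (k + 1) ?_
    let S : ShortComplex (ModuleCat.{u} R) := ShortComplex.mk
      (ModuleCat.ofHom (syzygyInclusion R N i)) (ModuleCat.ofHom (minimalCover R (syzygy R N i)))
      (by ext1; exact (syzygy_exact R N i).linearMap_comp_eq_zero)
    have hS : S.ShortExact :=
      { exact := (ShortComplex.moduleCat_exact_iff S).2 fun x hx => (syzygy_exact R N i x).1 hx
        mono_f := (ModuleCat.mono_iff_injective _).2 (syzygyInclusion_injective R N i)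
        epi_g := (ModuleCat.epi_iff_surjective _).2 (minimalCover_surjective R _) }
    have : Projective S.X₂ := (minimalResolution R N).projective i
    exact hS.hasProjectiveDimensionLT_X₃ k h (hasProjectiveDimensionLT_of_ge _ 1 _ (by omega))

theorem projectiveDimension_lt_top_of_subsingleton_syzygy (i : ℕ) (h : Subsingleton (syzygy R N i)) :
    projectiveDimension (ModuleCat.of R N) < ⊤ := by
  have h1 := hasProjectiveDimensionLT_of_syzygy (R := R) (N := N) i 0
    (ModuleCat.isZero_of_subsingleton _).hasProjectiveDimensionLT_zero
  exact (projectiveDimension_lt_iff.2 h1).trans_le le_top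

end Resolution

/-! ### Growth of depth along syzygies -/

section Depth

variable {R : Type u} [CommRing R] [IsLocalRing R]

theorem HasRegSeq.tensorProduct_flat {M : Type*} [AddCommGroup M] [Module R M] {n : ℕ}
    (h : HasRegSeq R M n) (F : Type*) [AddCommGroup F] [Module R F] [Module.Flat R F] :
    HasRegSeq R (M ⊗[R] F) n := by
  obtain ⟨rs, h1, h2, h3⟩ := h
  exact ⟨rs, h1, h2, h3.isWeaklyRegular_rTensor⟩

variable [IsNoetherianRing R] {M N : Type u} [AddCommGroup M] [Module R M] [Module.Finite R M]
  [AddCommGroup N] [Module R N] [Module.Finite R N]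

/-- The middle term M⊗F_i has depth at least n, so the depth lemma gains one at each syzygy until n
is reached. -/
theorem hasRegSeq_tensorProduct_syzygy {n v k : ℕ} (hM : HasRegSeq R M n)
    (hv : HasRegSeq R (M ⊗[R] N) v)
    (hTor : ∀ i : ℕ, 1 ≤ i → i ≤ k → Limits.IsZero
      (((Tor (ModuleCat.{u} R) i).obj (ModuleCat.of R M)).obj (ModuleCat.of R N)))
    {i : ℕ} (hi : i ≤ k) : HasRegSeq R (M ⊗[R] syzygy R N i) (min n (v + i)) := by
  induction i with
  | zero => exact hv.mono (by simp)
  | succ i ih =>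
    have h1 := HasRegSeq.of_exact_left
      (lTensor_syzygyInclusion_injective M i (hTor (i + 1) (by omega) hi))
      (LinearMap.lTensor_surjective M (minimalCover_surjective R (syzygy R N i)))
      (lTensor_exact M (syzygy_exact R N i) (minimalCover_surjective R _))
      (hM.tensorProduct_flat (resolutionTerm R N i)) (ih (by omega))
    exact h1.mono (by omega)

theorem hasRegSeq_of_le_depth {L : Type u} [AddCommGroup L] [Module R L] [Module.Finite R L] {n : ℕ}
    (h : n ≤ depth R L) : HasRegSeq R L n := by
  rcases n with _ | n
  · exact ⟨[], rfl, by simp, by simp⟩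
  have h1 : (n : ℕ∞) < depth R L := lt_of_lt_of_le (by exact_mod_cast Nat.lt_succ_self n) h
  obtain ⟨rs, h2⟩ := lt_iSup_iff.1 h1
  obtain ⟨hrs, h3⟩ := lt_iSup_iff.1 h2
  exact HasRegSeq.mono ⟨rs, rfl, hrs⟩ (by exact_mod_cast h3)

end Depth

end

/-! ### Free localizations and ranks -/

section FreeLocal

variable {S : Type*} [CommRing S] [IsLocalRing S] {A B C : Type*} [AddCommGroup A] [Module S A]
  [AddCommGroup B] [Module S B] [AddCommGroup C] [Module S C]

/-- The kernel of a surjection of finite free modules over a local ring is free, and ranks are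
additive. -/
theorem exists_linearEquiv_of_exact [Module.Free S B] [Module.Finite S B] {f : A →ₗ[S] B}
    {g : B →ₗ[S] C} (hf : Function.Injective f) (hg : Function.Surjective g)
    (hfg : Function.Exact f g) {r : ℕ} (e : C ≃ₗ[S] (Fin r → S)) :
    ∃ k, k + r = Module.finrank S B ∧ Nonempty (A ≃ₗ[S] (Fin k → S)) := by
  have : Module.Free S C := Module.Free.of_equiv e.symm
  have : Module.Finite S C := Module.Finite.equiv e.symm
  obtain ⟨l, hl⟩ := Module.projective_lifting_property g LinearMap.id hg
  obtain ⟨e', -, -⟩ := hfg.splitSurjectiveEquiv hf ⟨l, hl⟩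
  have : Module.Finite S (A × C) := Module.Finite.equiv e'
  have : Module.Finite S A := Module.Finite.of_surjective (LinearMap.fst S A C) LinearMap.fst_surjective
  have : Module.Projective S (A × C) := Module.Projective.of_equiv e'
  have : Module.Projective S A := Module.Projective.of_split (LinearMap.inl S A C)
    (LinearMap.fst S A C) (LinearMap.fst_comp_inl _ _ _)
  have : Module.Free S A := Module.free_of_flat_of_isLocalRing
  refine ⟨Module.finrank S A, ?_, ⟨LinearEquiv.ofFinrankEq _ _ (by simp)⟩⟩
  rw [e'.finrank_eq, Module.finrank_prod, e.finrank_eq]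
  simp

end FreeLocal

section LocalizedTensor

variable {R : Type*} [CommRing R] {M N : Type*} [AddCommGroup M] [Module R M] [AddCommGroup N]
  [Module R N]

theorem localLength_tensorProduct (p : PrimeSpectrum R) {r : ℕ}
    (e : LocalizedModule p.asIdeal.primeCompl N ≃ₗ[Localization p.asIdeal.primeCompl]
      (Fin r → Localization p.asIdeal.primeCompl)) :
    localLength p (M ⊗[R] N) = r * localLength p M := by
  let T := p.asIdeal.primeCompl
  let e' : LocalizedModule T (M ⊗[R] N) ≃ₗ[Localization T] (Fin r → LocalizedModule T M) :=
    LocalizedModule.equivTensorProduct T (M ⊗[R] N) ≪≫ₗ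
      TensorProduct.AlgebraTensorModule.distribBaseChange R (Localization T) M N ≪≫ₗ
      TensorProduct.congr (LocalizedModule.equivTensorProduct T M).symm
        ((LocalizedModule.equivTensorProduct T N).symm ≪≫ₗ e) ≪≫ₗ
      TensorProduct.piScalarRight (Localization T) (Localization T) (LocalizedModule T M) (Fin r)
  rw [localLength, e'.length_eq, Module.length_pi, ENat.card_eq_coe_fintype_card, Fintype.card_fin]
  rfl

/-- The rank of a free localization does not change under generization. -/
theorem nonempty_linearEquiv_of_le {p q : PrimeSpectrum R} (hqp : q.asIdeal ≤ p.asIdeal) {r : ℕ}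
    (e : LocalizedModule p.asIdeal.primeCompl N ≃ₗ[Localization p.asIdeal.primeCompl]
      (Fin r → Localization p.asIdeal.primeCompl)) :
    Nonempty (LocalizedModule q.asIdeal.primeCompl N ≃ₗ[Localization q.asIdeal.primeCompl]
      (Fin r → Localization q.asIdeal.primeCompl)) := by
  let P := p.asIdeal.primeCompl
  let Q := q.asIdeal.primeCompl
  have hle : P ≤ Q := fun x hx hxq => hx (hqp hxq)
  let : Algebra (Localization P) (Localization Q) :=
    IsLocalization.localizationAlgebraOfSubmonoidLe (Localization P) (Localization Q) P Q hle
  have : IsScalarTower R (Localization P) (Localization Q) :=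
    IsLocalization.localization_isScalarTower_of_submonoid_le (Localization P) (Localization Q) P Q hle
  exact ⟨LocalizedModule.equivTensorProduct Q N ≪≫ₗ
    (TensorProduct.AlgebraTensorModule.cancelBaseChange R (Localization P) (Localization Q)
      (Localization Q) N).symm ≪≫ₗ
    LinearEquiv.baseChange (Localization P) (Localization Q) _ _
      ((LocalizedModule.equivTensorProduct P N).symm ≪≫ₗ e) ≪≫ₗ
    TensorProduct.piScalarRight (Localization P) (Localization Q) (Localization Q) (Fin r)⟩

end LocalizedTensor

section Ranks

variable {R : Type u} [CommRing R]

theorem eq_of_linearEquiv_localization {p : PrimeSpectrum R} {N : Type*} [AddCommGroup N] [Module R N]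
    {r s : ℕ}
    (e : LocalizedModule p.asIdeal.primeCompl N ≃ₗ[Localization p.asIdeal.primeCompl]
      (Fin r → Localization p.asIdeal.primeCompl))
    (e' : LocalizedModule p.asIdeal.primeCompl N ≃ₗ[Localization p.asIdeal.primeCompl]
      (Fin s → Localization p.asIdeal.primeCompl)) : r = s := by
  have : Nontrivial (Localization p.asIdeal.primeCompl) :=
    inferInstanceAs (Nontrivial (Localization.AtPrime p.asIdeal))
  simpa using (e.symm ≪≫ₗ e').finrank_eq

variable [IsNoetherianRing R]

theorem exists_mem_Ass_le [Nontrivial R] (p : PrimeSpectrum R) :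
    ∃ q ∈ Ass R R, q.asIdeal ≤ p.asIdeal := by
  have h : Module.annihilator R R ≤ p.asIdeal := by
    rw [Module.annihilator_eq_bot.2 inferInstance]
    exact bot_le
  obtain ⟨q, hq, hqp⟩ := Ideal.exists_minimalPrimes_le h
  exact ⟨⟨q, hq.1.1⟩,
    Module.associatedPrimes.minimalPrimes_annihilator_subset_associatedPrimes R R hq, hqp⟩

theorem Ass_nonempty [Nontrivial R] : (Ass R R).Nonempty := by
  obtain ⟨q, hq⟩ := associatedPrimes.nonempty R R
  exact ⟨⟨q, hq.1⟩, hq⟩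

theorem HasRank.rank_eq [Nontrivial R] {N : Type*} [AddCommGroup N] [Module R N] {r : ℕ}
    (h : HasRank R N r) : rank R N = r := by
  obtain ⟨p, hp⟩ := Ass_nonempty (R := R)
  have h1 : {r : ℕ | HasRank R N r} = {r} := by
    ext s
    refine ⟨fun hs => ?_, fun hs => by rw [Set.mem_singleton_iff.1 hs]; exact h⟩
    obtain ⟨e⟩ := h p hp
    obtain ⟨e'⟩ := hs p hp
    exact eq_of_linearEquiv_localization e' e
  rw [rank, h1, csInf_singleton]

/-- Each p in Y contains an associated prime of R; localizing further to it preserves the rank of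
the free module N_p, which must then be r. -/
theorem HasRank.hasRankOn_union [Nontrivial R] {N : Type*} [AddCommGroup N] [Module R N]
    [Module.Finite R N] {r : ℕ} (h : HasRank R N r) {Y : Set (PrimeSpectrum R)}
    (hY : IsFreeOn Y N) : HasRankOn (Ass R R ∪ Y) N r := by
  rintro p (hp | hp)
  · exact h p hp
  obtain ⟨q, hq, hqp⟩ := exists_mem_Ass_le p
  have := hY p hp
  have : Nontrivial (Localization p.asIdeal.primeCompl) :=
    inferInstanceAs (Nontrivial (Localization.AtPrime p.asIdeal))
  have : Module.Finite (Localization p.asIdeal.primeCompl)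
      (LocalizedModule p.asIdeal.primeCompl N) :=
    Module.Finite.equiv (LocalizedModule.equivTensorProduct p.asIdeal.primeCompl N).symm
  have e := LinearEquiv.ofFinrankEq (R := Localization p.asIdeal.primeCompl)
    (LocalizedModule p.asIdeal.primeCompl N)
    (Fin (Module.finrank (Localization p.asIdeal.primeCompl)
      (LocalizedModule p.asIdeal.primeCompl N)) → Localization p.asIdeal.primeCompl) (by simp)
  obtain ⟨e₁⟩ := nonempty_linearEquiv_of_le hqp e
  obtain ⟨e₂⟩ := h q hq
  rw [eq_of_linearEquiv_localization e₂ e₁]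
  exact ⟨e⟩

/-- The localized sequence splits at each p, and the rank of the kernel, μ - r, does not depend on
p. -/
theorem HasRankOn.syzygy_succ {N : Type u} [AddCommGroup N] [Module R N] [Module.Finite R N]
    {Y : Set (PrimeSpectrum R)} (hY : Y.Nonempty) {i r : ℕ} (h : HasRankOn Y (syzygy R N i) r) :
    ∃ k, k + r = Nat.card (⊤ : Submodule R (syzygy R N i)).generators ∧
      HasRankOn Y (syzygy R N (i + 1)) k := by
  have key : ∀ p ∈ Y, ∃ k, k + r = Nat.card (⊤ : Submodule R (syzygy R N i)).generators ∧
      Nonempty (LocalizedModule p.asIdeal.primeCompl (syzygy R N (i + 1))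
        ≃ₗ[Localization p.asIdeal.primeCompl] (Fin k → Localization p.asIdeal.primeCompl)) := by
    intro p hp
    obtain ⟨e⟩ := h p hp
    have : IsLocalRing (Localization p.asIdeal.primeCompl) :=
      inferInstanceAs (IsLocalRing (Localization.AtPrime p.asIdeal))
    have hF := Module.Finite.equiv
      (LocalizedModule.equivTensorProduct p.asIdeal.primeCompl (resolutionTerm R N i)).symm
    have hfree := Module.Free.of_equiv
      (LocalizedModule.equivTensorProduct p.asIdeal.primeCompl (resolutionTerm R N i)).symm
    have hex : Function.Exact
        (LocalizedModule.map p.asIdeal.primeCompl (syzygyInclusion R N i))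
        (LocalizedModule.map p.asIdeal.primeCompl (minimalCover R (syzygy R N i))) :=
      LocalizedModule.map_exact p.asIdeal.primeCompl _ _ (syzygy_exact R N i)
    obtain ⟨k, hk, hk'⟩ := exists_linearEquiv_of_exact (S := Localization p.asIdeal.primeCompl)
      (A := LocalizedModule p.asIdeal.primeCompl (syzygy R N (i + 1)))
      (B := LocalizedModule p.asIdeal.primeCompl (resolutionTerm R N i))
      (C := LocalizedModule p.asIdeal.primeCompl (syzygy R N i))
      (f := LocalizedModule.map p.asIdeal.primeCompl (syzygyInclusion R N i))
      (g := LocalizedModule.map p.asIdeal.primeCompl (minimalCover R (syzygy R N i)))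
      (LocalizedModule.map_injective p.asIdeal.primeCompl _ (syzygyInclusion_injective R N i))
      (LocalizedModule.map_surjective p.asIdeal.primeCompl _ (minimalCover_surjective R (syzygy R N i)))
      hex e
    have : Nontrivial R := ⟨⟨0, 1, fun h => p.2.ne_top ((Ideal.eq_top_iff_one _).2 (h ▸ zero_mem _))⟩⟩
    refine ⟨k, ?_, hk'⟩
    rw [hk, (LocalizedModule.equivTensorProduct p.asIdeal.primeCompl
      (resolutionTerm R N i)).finrank_eq, Module.finrank_baseChange]
    have : Fintype (⊤ : Submodule R (syzygy R N i)).generators := Fintype.ofFinite _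
    rw [Module.finrank_finsupp_self, Nat.card_eq_fintype_card]
  obtain ⟨p, hp⟩ := hY
  obtain ⟨k, hk, -⟩ := key p hp
  refine ⟨k, hk, fun q hq => ?_⟩
  obtain ⟨k', hk', e⟩ := key q hq
  rwa [show k = k' by omega]

theorem HasRankOn.exists_syzygy {N : Type u} [AddCommGroup N] [Module R N] [Module.Finite R N]
    {Y : Set (PrimeSpectrum R)} (hY : Y.Nonempty) {r : ℕ} (h : HasRankOn Y N r) (i : ℕ) :
    ∃ k, HasRankOn Y (syzygy R N i) k := by
  induction i with
  | zero => exact ⟨r, h⟩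
  | succ i ih =>
    obtain ⟨k, hk⟩ := ih
    obtain ⟨k', -, hk'⟩ := hk.syzygy_succ hY
    exact ⟨k', hk'⟩

/-- A nonzero submodule of a free module is supported at an associated prime of the ring. -/
theorem exists_mem_Ass_mem_support {K : Type*} [AddCommGroup K] [Module R K] [Nontrivial K]
    {ι : Type*} {f : K →ₗ[R] (ι →₀ R)} (hf : Function.Injective f) :
    ∃ p ∈ Ass R R, p ∈ Module.support R K := by
  obtain ⟨x, hx⟩ := exists_ne (0 : K)
  have hfx : f x ≠ 0 := (map_ne_zero_iff f hf).2 hx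
  obtain ⟨g, hg⟩ := Finsupp.ne_iff.1 hfx
  obtain ⟨P, hP, hle⟩ := exists_le_isAssociatedPrime_of_isNoetherianRing R (f x g) hg
  refine ⟨⟨P, hP.1⟩, hP, Module.mem_support_iff_exists_annihilator.2 ⟨x, fun a ha => hle ?_⟩⟩
  rw [Submodule.mem_annihilator_span_singleton] at ha
  rw [Submodule.mem_colon_singleton, Submodule.mem_bot]
  rw [← Finsupp.smul_apply, ← map_smul, ha, map_zero, Finsupp.zero_apply]

variable {M : Type*} [AddCommGroup M] [Module R M]

/-- Since s > 0, R_p embeds in M_p, so pR_p is associated to M_p and contracts to an associated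
prime of M. -/
theorem mem_associatedPrimes_of_linearEquiv [Module.Finite R M] {p : PrimeSpectrum R} {s : ℕ} (hs : 0 < s)
    (e : LocalizedModule p.asIdeal.primeCompl M ≃ₗ[Localization p.asIdeal.primeCompl]
      (Fin s → Localization p.asIdeal.primeCompl)) (hp : p ∈ Ass R R) :
    p.asIdeal ∈ associatedPrimes R M := by
  have h1 := Module.associatedPrimes.mem_associatedPrimes_atPrime_of_mem_associatedPrimes hp
  have h2 : Function.Injective (LinearMap.single (Localization p.asIdeal.primeCompl)
      (fun _ : Fin s => Localization p.asIdeal.primeCompl) ⟨0, hs⟩) :=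
    fun a b h => by simpa using congrFun h ⟨0, hs⟩
  let e₀ : LocalizedModule p.asIdeal.primeCompl R ≃ₗ[Localization p.asIdeal.primeCompl]
      Localization p.asIdeal.primeCompl :=
    LocalizedModule.equivTensorProduct p.asIdeal.primeCompl R ≪≫ₗ
      TensorProduct.AlgebraTensorModule.rid R (Localization p.asIdeal.primeCompl) _
  have h3 := associatedPrimes.subset_of_injective
    (f := e.symm.toLinearMap ∘ₗ LinearMap.single (Localization p.asIdeal.primeCompl)
      (fun _ : Fin s => Localization p.asIdeal.primeCompl) ⟨0, hs⟩ ∘ₗ e₀.toLinearMap)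
    (e.symm.injective.comp (h2.comp e₀.injective)) h1
  have h4 := Module.associatedPrimes.comap_mem_associatedPrimes_of_mem_associatedPrimes_of_isLocalizedModule_of_fg
    p.asIdeal.primeCompl (LocalizedModule.mkLinearMap p.asIdeal.primeCompl M) _ h3
    (IsNoetherian.noetherian _)
  have h5 : Ideal.comap (algebraMap R (Localization p.asIdeal.primeCompl))
      (maximalIdeal (Localization.AtPrime p.asIdeal)) = p.asIdeal :=
    Localization.AtPrime.under_maximalIdeal
  rwa [h5] at h4

theorem HasRank.support_eq_univ [Nontrivial R] [Module.Finite R M] {s : ℕ} (hs : 0 < s)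
    (h : HasRank R M s) : Module.support R M = Set.univ := by
  refine Set.eq_univ_of_forall fun p => ?_
  obtain ⟨q, hq, hqp⟩ := exists_mem_Ass_le p
  refine Module.mem_support_mono hqp ?_
  obtain ⟨e⟩ := h q hq
  have : Nontrivial (Localization q.asIdeal.primeCompl) :=
    inferInstanceAs (Nontrivial (Localization.AtPrime q.asIdeal))
  have : Nonempty (Fin s) := ⟨⟨0, hs⟩⟩
  exact Module.mem_support_iff.2 e.toEquiv.nontrivial

end Ranks

/-! ### Contraction of rank and multiplicity along syzygies -/

section Main

variable {R : Type u} [CommRing R] [IsLocalRing R] [IsNoetherianRing R]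
  {M : Type u} [AddCommGroup M] [Module R M] [Module.Finite R M] {n : ℕ}

theorem multiplicity_eq {L : Type*} [AddCommGroup L] [Module R L] {e : ℝ}
    (hL : Module.supportDim R L = n) (h : HasMult R L n e) :
    multiplicity (maximalIdeal R) L = e := by
  have hd : dimNat R L = n := by
    rw [dimNat, hL]
    rfl
  rw [multiplicity, hd, h.limUnder_eq, mul_div_cancel₀]
  positivity

theorem colength_pos [Nontrivial M] : 0 < colength (maximalIdeal R) M := by
  have h1 : Nontrivial (M ⧸ (maximalIdeal R • (⊤ : Submodule R M))) :=
    Submodule.Quotient.nontrivial_iff.2 (smul_top_lt_top M).ne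
  have h2 := length_quotient_ne_top (R := R) 1 M
  rw [pow_one] at h2
  rw [colength, Nat.pos_iff_ne_zero]
  intro h
  rcases ENat.toNat_eq_zero.1 h with h | h
  · exact Module.length_pos.ne' h
  · exact h2 h

theorem generators_mul_colength_le {L : Type u} [AddCommGroup L] [Module R L] [Module.Finite R L]
    (hdim : Module.supportDim R M = n) (hL : HasRegSeq R (M ⊗[R] L) n) {e : ℝ}
    (he : HasMult R (M ⊗[R] L) n e) :
    (Nat.card (⊤ : Submodule R L).generators : ℝ) * colength (maximalIdeal R) M ≤ e := by
  obtain ⟨e', h1, -, h2⟩ := hilbertSamuel n R (M ⊗[R] L) (supportDim_tensorProduct_le.trans hdim.le)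
  rw [he.unique h1]
  have := h2 hL
  rw [colength_tensorProduct] at this
  exact_mod_cast this

/-- Only primes of Supp M with dim R/p = n count. They are minimal over the annihilator of M, hence
associated to M, and there L is free of rank r. -/
theorem HasMult.tensorProduct_of_hasRankOn {L : Type u} [AddCommGroup L] [Module R L]
    [Module.Finite R L] (hdim : Module.supportDim R M = n) {r : ℕ} (hr : HasRankOn (Ass R M) L r)
    {e : ℝ} (he : HasMult R M n e) : HasMult R (M ⊗[R] L) n (r * e) := by
  refine HasMult.of_localLength_eq (supportDim_tensorProduct_le.trans hdim.le) hdim.le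
    (fun p hp => ?_) he
  by_cases hpM : p ∈ Module.support R M
  · obtain ⟨e⟩ := hr p (Module.associatedPrimes.minimalPrimes_annihilator_subset_associatedPrimes R M
      (mem_minimalPrimes_annihilator_of_supportDim_le hdim.le hpM hp))
    exact localLength_tensorProduct p e
  · have h1 : p ∉ Module.support R (M ⊗[R] L) := fun h => hpM (by
      rw [Module.mem_support_iff_of_finite] at h ⊢
      exact annihilator_le_annihilator_tensorProduct.trans h)
    rw [(localLength_eq_zero_iff p).2 h1, (localLength_eq_zero_iff p).2 hpM, mul_zero]

theorem HasRank.hasMult_tensorProduct (hR : Module.supportDim R R = n) {s : ℕ} (hs : HasRank R M s)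
    {L : Type u} [AddCommGroup L] [Module R L] [Module.Finite R L] {e : ℝ}
    (he : HasMult R L n e) : HasMult R (L ⊗[R] M) n (s * e) := by
  have hle : ∀ (X : Type u) [AddCommGroup X] [Module R X], Module.supportDim R X ≤ n := fun X _ _ =>
    ((Module.supportDim_le_ringKrullDim R X).trans_eq
      (Module.supportDim_self_eq_ringKrullDim (R := R)).symm).trans_eq hR
  refine HasMult.of_localLength_eq (hle _) (hle _) (fun p hp => ?_) he
  obtain ⟨e⟩ := hs p (Module.associatedPrimes.minimalPrimes_annihilator_subset_associatedPrimes R R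
    (mem_minimalPrimes_annihilator_of_supportDim_le hR.le
      (by simp [Module.mem_support_iff_of_finite, Module.annihilator_eq_bot.2]) hp))
  exact localLength_tensorProduct p e

variable {N : Type u} [AddCommGroup N] [Module R N] [Module.Finite R N]

/-- Ass M serves to compute e(M⊗X) = rank(X) e(M), which yields the factor c-1; Ass R serves to
conclude that a syzygy of rank zero vanishes. -/
theorem subsingleton_syzygy_of_hasRankOn [Nontrivial M] (hdim : Module.supportDim R M = n)
    {c e : ℝ} (hc : 1 ≤ c) (he : HasMult R M n e) (hec : e ≤ c * colength (maximalIdeal R) M)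
    {k t r : ℕ} (hr : HasRankOn (Ass R R ∪ Ass R M) (syzygy R N k) r)
    (hrt : (r : ℝ) * (c - 1) ^ (t + 1) < 1)
    (hreg : ∀ i ≤ t, HasRegSeq R (M ⊗[R] syzygy R N (k + i)) n) :
    Subsingleton (syzygy R N (k + (t + 1))) := by
  have hY : (Ass R R ∪ Ass R M).Nonempty := Ass_nonempty.inl
  have hμ : (0 : ℝ) < colength (maximalIdeal R) M := by exact_mod_cast colength_pos (R := R) (M := M)
  have key : ∀ i ≤ t + 1, ∃ b : ℕ, HasRankOn (Ass R R ∪ Ass R M) (syzygy R N (k + i)) b ∧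
      (b : ℝ) ≤ r * (c - 1) ^ i := by
    intro i
    induction i with
    | zero => exact fun _ => ⟨r, hr, by simp⟩
    | succ i ih =>
      intro hi
      obtain ⟨a, ha, har⟩ := ih (by omega)
      obtain ⟨b, hb, hb'⟩ := ha.syzygy_succ hY
      refine ⟨b, hb', ?_⟩
      have h1 := generators_mul_colength_le hdim (hreg i (by omega))
        (HasMult.tensorProduct_of_hasRankOn hdim (fun p hp => ha p (Or.inr hp)) he)
      rw [← hb] at h1
      push_cast at h1
      have h2 : ((b : ℝ) + a) * colength (maximalIdeal R) M ≤
          (a * c) * colength (maximalIdeal R) M := by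
        rw [mul_assoc (a : ℝ)]
        exact h1.trans (mul_le_mul_of_nonneg_left hec (Nat.cast_nonneg a))
      have h3 := le_of_mul_le_mul_right h2 hμ
      have h4 := mul_le_mul_of_nonneg_right har (sub_nonneg.2 hc)
      rw [pow_succ, ← mul_assoc]
      linarith
  obtain ⟨b, hb, hbr⟩ := key (t + 1) le_rfl
  have hb0 : b = 0 := by
    have : (b : ℝ) < 1 := hbr.trans_lt hrt
    exact Nat.lt_one_iff.1 (by exact_mod_cast this)
  subst hb0
  by_contra hne
  rw [not_subsingleton_iff_nontrivial] at hne
  obtain ⟨p, hp, hps⟩ := exists_mem_Ass_mem_support (syzygyInclusion_injective R N (k + t))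
  obtain ⟨e⟩ := hb p (Or.inl hp)
  exact Module.notMem_support_iff.2 e.toEquiv.subsingleton hps

/-- Positive rank gives M full support, so dim R = n and e(R) is available in degree n. It replaces
the rank count by e(ΩX) + e(X) = μ(X) e(R). -/
theorem subsingleton_syzygy_of_hasRank [Nontrivial M] (hdim : Module.supportDim R M = n)
    (hMreg : HasRegSeq R M n) {s : ℕ} (hs0 : 0 < s) (hs : HasRank R M s)
    {c e : ℝ} (hc : 1 ≤ c) (he : HasMult R M n e) (hec : e ≤ c * colength (maximalIdeal R) M)
    {k t : ℕ}
    (ht : multiplicity (maximalIdeal R) (syzygy R N k) * (c - 1) ^ (t + 1) < 1)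
    (hreg : ∀ i ≤ t, HasRegSeq R (M ⊗[R] syzygy R N (k + i)) n) :
    Subsingleton (syzygy R N (k + (t + 1))) := by
  have hR : Module.supportDim R R = n := by
    rw [← hdim, Module.supportDim, Module.supportDim, hs.support_eq_univ hs0]
    congr 2
    all_goals
      try simp only [Module.support_eq_zeroLocus, Module.annihilator_eq_bot.2 inferInstance]
      simp
  have hle : ∀ (X : Type u) [AddCommGroup X] [Module R X], Module.supportDim R X ≤ n := fun X _ _ =>
    ((Module.supportDim_le_ringKrullDim R X).trans_eq
      (Module.supportDim_self_eq_ringKrullDim (R := R)).symm).trans_eq hR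
  obtain ⟨eR, heR, -⟩ := hilbertSamuel n R R hR.le
  have heM : e = s * eR :=
    he.unique ((hs.hasMult_tensorProduct hR heR).congr (TensorProduct.lid R M))
  have hs' : (0 : ℝ) < s := by exact_mod_cast hs0
  obtain ⟨a, ha, ha', -⟩ := hilbertSamuel n R (syzygy R N k) (hle _)
  have key : ∀ i ≤ t + 1, ∃ b : ℝ, HasMult R (syzygy R N (k + i)) n b ∧ b ≤ a * (c - 1) ^ i := by
    intro i
    induction i with
    | zero => exact fun _ => ⟨a, ha, by simp⟩
    | succ i ih =>
      intro hi
      obtain ⟨x, hx, hxa⟩ := ih (by omega)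
      obtain ⟨b, hb, -⟩ := hilbertSamuel n R (syzygy R N (k + i + 1)) (hle _)
      refine ⟨b, hb, ?_⟩
      have h1 := generators_mul_colength_le hdim (hreg i (by omega))
        ((hs.hasMult_tensorProduct hR hx).congr (TensorProduct.comm R _ _))
      have h2 := (HasMult.of_exact (syzygyInclusion_injective R N (k + i))
        (minimalCover_surjective R _) (syzygy_exact R N (k + i)) hb hx).unique
        ((heR.tensorProduct_free (⊤ : Submodule R (syzygy R N (k + i))).generators).congr
          (TensorProduct.lid R _))
      set β : ℝ := ((Nat.card (⊤ : Submodule R (syzygy R N (k + i))).generators : ℕ) : ℝ)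
      have hβ : 0 ≤ β := Nat.cast_nonneg _
      have h3 : s * ((b : ℝ) + x) ≤ s * (c * x) := by
        calc s * ((b : ℝ) + x) = β * e := by rw [h2, heM]; ring
          _ ≤ β * (c * colength (maximalIdeal R) M) := mul_le_mul_of_nonneg_left hec hβ
          _ = c * (β * colength (maximalIdeal R) M) := by ring
          _ ≤ c * (s * x) := mul_le_mul_of_nonneg_left h1 (by linarith)
          _ = s * (c * x) := by ring
      have h4 := le_of_mul_le_mul_left h3 hs'
      have h5 := mul_le_mul_of_nonneg_right hxa (sub_nonneg.2 hc)
      rw [pow_succ, ← mul_assoc]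
      linarith
  -- `multiplicity` is normalised by the dimension of the module itself, whereas a is taken in
  -- degree n; they agree in dimension n, and a = 0 in smaller dimension.
  have hat : (a : ℝ) * (c - 1) ^ (t + 1) < 1 := by
    rcases (hle (syzygy R N k)).eq_or_lt with h | h
    · rwa [multiplicity_eq h ha] at ht
    · rw [ha.unique (hasMult_zero_of_supportDim_lt _ h), zero_mul]
      exact one_pos
  obtain ⟨b, hb, hba⟩ := key (t + 1) le_rfl
  obtain ⟨b', hb', hb1, -⟩ := hilbertSamuel n R (syzygy R N (k + (t + 1))) (hle _)
  rw [hb.unique hb'] at hba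
  have hb0 : b' < 1 := by exact_mod_cast hba.trans_lt hat
  by_contra hne
  rw [not_subsingleton_iff_nontrivial] at hne
  -- An associated prime p of R is associated to M, and depth M ≥ n forces dim R/p ≥ n. A nonzero
  -- syzygy would thus have dimension n and multiplicity at least 1.
  obtain ⟨p, hp, hps⟩ := exists_mem_Ass_mem_support (syzygyInclusion_injective R N (k + t))
  obtain ⟨f⟩ := hs p hp
  have h1 := hMreg.le_supportDim_quotient (mem_associatedPrimes_of_linearEquiv hs0 f hp)
  have h2 := hb1 (le_antisymm (hle _) (h1.trans (supportDim_quotient_le_of_mem_support hps)))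
  omega

end Main

end CUlrich

theorem mainTheorem7 {R : Type u} [CommRing R] [IsLocalRing R] [IsNoetherianRing R]
    (M N : Type u) [AddCommGroup M] [Module R M] [Module.Finite R M] [Nontrivial M]
    [AddCommGroup N] [Module R N] [Module.Finite R N]
    (c : ℝ) (hc : c < 2) (hM : CUlrich.IsUlrich R c M)
    (hrank : (∃ r : ℕ, 0 < r ∧ CUlrich.HasRank R M r) ∨
      ((∃ r : ℕ, CUlrich.HasRank R N r) ∧ CUlrich.IsFreeOn (CUlrich.Ass R M) N))
    (n v t : ℕ)
    (hn : Module.supportDim R M = n)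
    (hv : v = (CUlrich.depth R (M ⊗[R] N)).toNat)
    (ht₁ : ((∃ r : ℕ, CUlrich.HasRank R N r) ∧ CUlrich.IsFreeOn (CUlrich.Ass R M) N) →
      IsLeast {k : ℕ | (CUlrich.rank R (CUlrich.syzygy R N (n - v)) : ℝ) * (c - 1) ^ (k + 1) < 1} t)
    (ht₂ : ¬((∃ r : ℕ, CUlrich.HasRank R N r) ∧ CUlrich.IsFreeOn (CUlrich.Ass R M) N) →
      IsLeast {k : ℕ | CUlrich.multiplicity (maximalIdeal R) (CUlrich.syzygy R N (n - v))
        * (c - 1) ^ (k + 1) < 1} t)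
    (hTor : ∀ i : ℕ, 1 ≤ i → i ≤ n - v + t →
      Limits.IsZero (((Tor (ModuleCat.{u} R) i).obj (ModuleCat.of R M)).obj (ModuleCat.of R N))) :
    projectiveDimension (ModuleCat.of R N) < ⊤ := by
  open CUlrich in
  have hMreg : HasRegSeq R M n := by
    rcases hM.isCohenMacaulay with h | h
    · exact absurd h (not_subsingleton M)
    · rw [hn] at h
      exact hasRegSeq_of_le_depth (ge_of_eq (WithBot.coe_injective h))
  have hreg : ∀ i ≤ t, HasRegSeq R (M ⊗[R] syzygy R N (n - v + i)) n := fun i hi => by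
    -- For infinite depth v is 0, which is still a lower bound for the depth.
    have hMN : HasRegSeq R (M ⊗[R] N) v :=
      hasRegSeq_of_le_depth (by rw [hv]; exact ENat.natCast_toNat_le_self _)
    exact (hasRegSeq_tensorProduct_syzygy hMreg hMN hTor (by omega)).mono (by omega)
  obtain ⟨e, he, -, hμ⟩ := hilbertSamuel n R M hn.le
  have hec : (e : ℝ) ≤ c * colength (maximalIdeal R) M := by
    have := hM.multiplicity_le
    rwa [multiplicity_eq hn he] at this
  have hμ0 : (0 : ℝ) < colength (maximalIdeal R) M := by
    exact_mod_cast colength_pos (R := R) (M := M)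
  -- Since M is Cohen-Macaulay, μ(M) ≤ e(M) ≤ c μ(M) with μ(M) > 0; this makes c - 1 nonnegative, as
  -- the iteration needs.
  have hc1 : 1 ≤ c := by
    have h1 : (colength (maximalIdeal R) M : ℝ) ≤ e := by exact_mod_cast hμ hMreg
    exact le_of_mul_le_mul_right (by linarith) hμ0
  refine projectiveDimension_lt_top_of_subsingleton_syzygy (n - v + (t + 1)) ?_
  by_cases hA : (∃ r : ℕ, HasRank R N r) ∧ IsFreeOn (Ass R M) N
  · obtain ⟨⟨r, hr⟩, hfree⟩ := hA
    obtain ⟨k, hk⟩ := (hr.hasRankOn_union hfree).exists_syzygy Ass_nonempty.inl (n - v)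
    have hk' : HasRank R (syzygy R N (n - v)) k := fun p hp => hk p (Or.inl hp)
    have ht := (ht₁ ⟨⟨r, hr⟩, hfree⟩).1
    rw [Set.mem_ofPred_eq, hk'.rank_eq] at ht
    exact subsingleton_syzygy_of_hasRankOn hn hc1 he hec hk ht hreg
  · obtain ⟨s, hs0, hs⟩ := hrank.resolve_right hA
    exact subsingleton_syzygy_of_hasRank hn hMreg hs0 hs hc1 he hec (ht₂ hA).1 hreg
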